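/- \textbf{Nominal coalgebraic data types.} Let $\mathcal V$ be a countably infinite set of names and $\mathfrak S(\mathcal V)$ the group of permutations of $\mathcal V$ generated by transpositions. Let $\mathsf{Nom}$ be the category of nominal sets (sets with an $\mathfrak S(\mathcal V)$-action all of whose elements are finitely supported) and equivariant maps. For a nominal set $X$ let $[\mathcal V]X$ be the quotient of $\mathcal V\times X$ by $(x_1,u_1)\sim(x_2,u_2)$ iff $(x_1\,z)\cdot u_1=(x_2\,z)\cdot u_2$ for some name $z$ fresh for $x_1,u_1,x_2,u_2$, with action $\pi\cdot\langle x\rangle u=\langle\pi x\rangle(\pi\cdot u)$, where $\langle x\rangle u$ is the class of $(x,u)$; and $[\mathcal V]f(\langle x\rangle u)=\langle x\rangle f(u)$. Let $(\Sigma,\mathsf{ar})$ be a binding signature, i.e. a set $\Sigma$ of operations with arities $\mathsf{ar}(\mathsf{op})=n_1,\ldots,n_k\in\mathbb N^*$. The set $T^\infty_\Sigma$ of infinitary raw terms is defined coinductively: a raw term is a name $x\in\mathcal V$ or $\mathsf{op}(\langle\overline{x_1}\rangle.t_1,\ldots,\langle\overline{x_k}\rangle.t_k)$ with $\mathsf{op}\in\Sigma$,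 $\mathsf{ar}(\mathsf{op})=n_1,\ldots,n_k$, raw terms $t_i$, and lists $\overline{x_i}$ of $n_i$ names (repetitions allowed). Permutations act on all names of a raw term, bound or not. The truncation $t^n$ is the finite term given by $t^0=*$ (a constant), $x^{n+1}=x$ and $\mathsf{op}(\ldots,\langle\overline{x_i}\rangle.t_i,\ldots)^{n+1}=\mathsf{op}(\ldots,\langle\overline{x_i}\rangle.t_i^{\,n},\ldots)$. On finite terms, $\mathsf{fv}(*)=\emptyset$, $\mathsf{fv}(x)=\{x\}$ and $\mathsf{fv}(\mathsf{op}(\langle\overline{x_1}\rangle.t_1,\ldots,\langle\overline{x_k}\rangle.t_k))=\bigcup_i(\mathsf{fv}(t_i)\setminus\overline{x_i})$, and $=_\alpha$ is defined inductively by $*=_\alpha *$, $x=_\alpha x$, and $\mathsf{op}(\langle\overline{x_1}\rangle.t_1,\ldots,\langle\overline{x_k}\rangle.t_k)=_\alpha\mathsf{op}(\langle\overline{y_1}\rangle.s_1,\ldots,\langle\overline{y_k}\rangle.s_k)$ whenever for each $i$ there is a list $\overline{z_i}$ of $n_i$ distinct names not occurring in either of these two terms with $(\overline{x_i}\;\overline{z_i})\cdot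 t_i=_\alpha(\overline{y_i}\;\overline{z_i})\cdot s_i$, where $(\overline x\;\overline z)$ is the composite $(x^1\,z^1)\cdots(x^{m}\,z^{m})$. For $t,s\in T^\infty_\Sigma$ put $t=_\alpha s$ iff $t^n=_\alpha s^n$ for all $n$, and $\mathsf{fv}(t)=\bigcup_n\mathsf{fv}(t^n)$. Let $(T^\infty_\Sigma)_{\mathrm{ffv}}$ be the set of raw terms $t\in T^\infty_\Sigma$ with $\mathsf{fv}(t)$ finite. Then $(T^\infty_\Sigma)_{\mathrm{ffv}}/{=_\alpha}$, with the action $\pi\cdot[t]_\alpha=[\pi\cdot t]_\alpha$, is a nominal set, and it is the carrier of a final coalgebra for the functor $F_\alpha:\mathsf{Nom}\to\mathsf{Nom}$, $$F_\alpha X=\mathcal V+\coprod_{\substack{\mathsf{op}\in\Sigma\\ \mathsf{ar}(\mathsf{op})=n_1,\ldots,n_k}}[\mathcal V]^{n_1}X\times\cdots\times[\mathcal V]^{n_k}X,$$ whose structure map sends $[x]_\alpha$ to $x$ and $[\mathsf{op}(\langle\overline{x_1}\rangle.t_1,\ldots,\langle\overline{x_k}\rangle.t_k)]_\alpha$ to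 the tuple $(\langle x_i^1\rangle\cdots\langle x_i^{n_i}\rangle[t_i]_\alpha)_{1\le i\le k}$ in the summand of $\mathsf{op}$. In particular, regard infinitary $\lambda$-terms as the infinitary raw terms for the signature with two operations, abstraction of arity $1$ and application of arity $0,0$. Then the nominal set of $\alpha$-equivalence classes of infinitary $\lambda$-terms with finitely many free variables is the carrier of a final coalgebra for $L_\alpha X=\mathcal V+[\mathcal V]X+X\times X$, whose structure map sends $[x]_\alpha$ to $x$, $[\lambda x.M]_\alpha$ to $\langle x\rangle[M]_\alpha$ and $[MN]_\alpha$ to $([M]_\alpha,[N]_\alpha)$. -/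

import Mathlib

open CategoryTheory

universe u

namespace NominalData

/-! ### Nominal sets -/

/-- The group of permutations of `V` generated by the transpositions. -/
abbrev FinPerm (V : Type u) [DecidableEq V] : Type u :=
  ↥(Subgroup.closure {σ : Equiv.Perm V | σ.IsSwap})

/-- The transposition `(x y)` (the identity if `x = y`). -/
def transp {V : Type u} [DecidableEq V] (x y : V) : FinPerm V :=
  ⟨Equiv.swap x y, by
    by_cases h : x = y
    · subst h
      rw [Equiv.swap_self]
      exact Subgroup.one_mem _
    · exact Subgroup.subset_closure ⟨x, y, h, rfl⟩⟩

section Support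

variable {V : Type u} [DecidableEq V] {X : Type*} [MulAction (FinPerm V) X]

theorem transp_smul (x y a : V) : transp x y • a = Equiv.swap x y a := rfl

/-- `u` is supported by some finite set of names. -/
def FinSupp (V : Type u) [DecidableEq V] {X : Type*} [MulAction (FinPerm V) X] (u : X) : Prop :=
  ∃ S : Finset V, MulAction.Supports (FinPerm V) (S : Set V) u

/-- The intersection of all finite supports of `u`; for infinite `V` and finitely supported `u`
this is the least finite support of `u`. -/
def supp (V : Type u) [DecidableEq V] {X : Type*} [MulAction (FinPerm V) X] (u : X) : Set V :=
  {a | ∀ S : Finset V, MulAction.Supports (FinPerm V) (S : Set V) u → a ∈ S}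

/-- `z # u`: the name `z` is fresh for `u`. -/
def Fresh (z : V) (u : X) : Prop := z ∉ supp V u

theorem fresh_iff (z : V) (u : X) :
    Fresh z u ↔ ∃ S : Finset V, MulAction.Supports (FinPerm V) (S : Set V) u ∧ z ∉ S := by
  simp [Fresh, supp]

theorem supports_smul {S : Finset V} {u : X} (π : FinPerm V)
    (h : MulAction.Supports (FinPerm V) (S : Set V) u) :
    MulAction.Supports (FinPerm V) ((S.image (fun a => π • a) : Finset V) : Set V) (π • u) := by
  intro g hg
  have h1 : (π⁻¹ * g * π) • u = u := by
    apply h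
    intro a ha
    have h2 : g • (π • a) = π • a := hg (Finset.mem_coe.2 (Finset.mem_image_of_mem _ ha))
    rw [mul_smul, mul_smul, h2, inv_smul_smul]
  rw [mul_smul, mul_smul, inv_smul_eq_iff] at h1
  exact h1

theorem FinSupp.smul {u : X} (π : FinPerm V) (h : FinSupp V u) : FinSupp V (π • u) :=
  let ⟨_, hS⟩ := h
  ⟨_, supports_smul π hS⟩

theorem Fresh.smul {z : V} {u : X} (π : FinPerm V) (h : Fresh z u) : Fresh (π • z) (π • u) := by
  rw [fresh_iff] at h ⊢
  obtain ⟨S, hS, hz⟩ := h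
  refine ⟨_, supports_smul π hS, ?_⟩
  intro hmem
  obtain ⟨a, ha, hab⟩ := Finset.mem_image.1 hmem
  have : a = z := MulAction.injective π hab
  exact hz (this ▸ ha)

theorem Supports.map {Y : Type*} [MulAction (FinPerm V) Y] (f : X →[FinPerm V] Y) {S : Set V}
    {u : X} (h : MulAction.Supports (FinPerm V) S u) : MulAction.Supports (FinPerm V) S (f u) :=
  fun g hg => by rw [← map_smul, h g hg]

theorem Fresh.map {Y : Type*} [MulAction (FinPerm V) Y] (f : X →[FinPerm V] Y) {z : V} {u : X}
    (h : Fresh z u) : Fresh z (f u) := by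
  rw [fresh_iff] at h ⊢
  obtain ⟨S, hS, hz⟩ := h
  exact ⟨S, Supports.map f hS, hz⟩

theorem Supports.transp {S : Finset V} {u : X}
    (h : MulAction.Supports (FinPerm V) (S : Set V) u) {z w : V} (hz : z ∉ S) (hw : w ∉ S) :
    transp z w • u = u := by
  apply h
  intro a ha
  rw [transp_smul]
  exact Equiv.swap_apply_of_ne_of_ne (fun h => hz (h ▸ ha)) (fun h => hw (h ▸ ha))

theorem transp_conj {x y z : V} (h2 : y ≠ x) (h3 : y ≠ z) :
    transp x z * transp z y * transp x z = transp x y := by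
  apply Subtype.ext
  change Equiv.swap x z * Equiv.swap z y * Equiv.swap x z = Equiv.swap x y
  rw [Equiv.swap_comm x z, Equiv.swap_comm z y, Equiv.swap_mul_swap_mul_swap h3 h2]

theorem Fresh.transp [Infinite V] {z w : V} {u : X} (hz : Fresh z u) (hw : Fresh w u) :
    transp z w • u = u := by
  by_cases hzw : z = w
  · subst hzw
    have : NominalData.transp z z = 1 := Subtype.ext (Equiv.swap_self z)
    rw [this, one_smul]
  rw [fresh_iff] at hz hw
  obtain ⟨S, hS, hzS⟩ := hz
  obtain ⟨T, hT, hwT⟩ := hw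
  obtain ⟨v, hv⟩ := Infinite.exists_notMem_finset (S ∪ T ∪ {z, w})
  simp only [Finset.mem_union, Finset.mem_insert, Finset.mem_singleton, not_or] at hv
  rw [← transp_conj (x := z) (y := w) (z := v) (Ne.symm hzw)
      (Ne.symm hv.2.2), mul_smul, mul_smul,
    Supports.transp hS hzS hv.1.1, Supports.transp hT hv.1.2 hwT, Supports.transp hS hzS hv.1.1]

theorem finSupp_name (V : Type u) [DecidableEq V] (x : V) : FinSupp V x :=
  ⟨{x}, fun _ hg => hg (by simp)⟩

theorem FinSupp.exists_finset {u : X} (h : FinSupp V u) :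
    ∃ S : Finset V, ∀ z, z ∉ S → Fresh z u := by
  obtain ⟨S, hS⟩ := h
  exact ⟨S, fun z hz => (fresh_iff z u).2 ⟨S, hS, hz⟩⟩

theorem smul_transp (π : FinPerm V) (x y : V) (u : X) :
    π • transp x y • u = transp (π • x) (π • y) • π • u := by
  rw [smul_smul, smul_smul]
  congr 1
  apply Subtype.ext
  exact Equiv.mul_swap_eq_swap_mul π.1 x y

end Support

/-- A nominal set over the set of names `V`. -/
structure Nom (V : Type u) [DecidableEq V] where
  carrier : Type u
  [action : MulAction (FinPerm V) carrier]
  finSupp : ∀ u : carrier, FinSupp V u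

namespace Nom

variable {V : Type u} [DecidableEq V]

instance : CoeSort (Nom V) (Type u) := ⟨Nom.carrier⟩

instance (X : Nom V) : MulAction (FinPerm V) X := X.action

/-- The category of nominal sets and equivariant maps. -/
instance : Category (Nom V) where
  Hom X Y := X →[FinPerm V] Y
  id X := MulActionHom.id (FinPerm V)
  comp f g := MulActionHom.comp g f

/-- The equivariant map underlying a morphism. -/
abbrev map {X Y : Nom V} (f : X ⟶ Y) : X →[FinPerm V] Y := f

@[ext]
theorem hom_ext {X Y : Nom V} {f g : X ⟶ Y} (h : ∀ u, map f u = map g u) : f = g :=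
  MulActionHom.ext h

end Nom

/-! ### The abstraction functor -/

section Abstraction

variable {V : Type u} [DecidableEq V]

/-- `(x₁, u₁) ∼ (x₂, u₂)` iff `(x₁ z) · u₁ = (x₂ z) · u₂` for some `z # x₁, u₁, x₂, u₂`. -/
def AbsRel (X : Nom V) (p q : V × X) : Prop :=
  ∃ z : V, z ≠ p.1 ∧ z ≠ q.1 ∧ Fresh z p.2 ∧ Fresh z q.2 ∧
    transp p.1 z • p.2 = transp q.1 z • q.2

theorem transp_transp [Infinite V] {X : Nom V} {x z v : V} {u : X} (hz : z ≠ x) (hv : v ≠ x)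
    (hzu : Fresh z u) (hvu : Fresh v u) : transp z v • transp x z • u = transp x v • u := by
  rw [smul_transp, hzu.transp hvu, transp_smul, transp_smul, Equiv.swap_apply_left,
    Equiv.swap_apply_of_ne_of_ne (Ne.symm hz) (Ne.symm hv)]

theorem AbsRel.equivalence [Infinite V] (X : Nom V) : Equivalence (AbsRel X) where
  refl p := by
    obtain ⟨S, hS⟩ := (X.finSupp p.2).exists_finset
    obtain ⟨z, hz⟩ := Infinite.exists_notMem_finset (S ∪ {p.1})
    simp only [Finset.mem_union, Finset.mem_singleton, not_or] at hz
    exact ⟨z, hz.2, hz.2, hS z hz.1, hS z hz.1, rfl⟩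
  symm := fun ⟨z, h1, h2, h3, h4, h5⟩ => ⟨z, h2, h1, h4, h3, h5.symm⟩
  trans := by
    rintro p q r ⟨z, h1, h2, h3, h4, h5⟩ ⟨w, k1, k2, k3, k4, k5⟩
    obtain ⟨S, hS⟩ := (X.finSupp p.2).exists_finset
    obtain ⟨T, hT⟩ := (X.finSupp q.2).exists_finset
    obtain ⟨R, hR⟩ := (X.finSupp r.2).exists_finset
    obtain ⟨v, hv⟩ := Infinite.exists_notMem_finset (S ∪ T ∪ R ∪ {p.1, q.1, r.1})
    simp only [Finset.mem_union, Finset.mem_insert, Finset.mem_singleton, not_or] at hv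
    obtain ⟨⟨⟨v1, v2⟩, v3⟩, v4, v5, v6⟩ := hv
    refine ⟨v, v4, v6, hS v v1, hR v v3, ?_⟩
    rw [← transp_transp h1 v4 h3 (hS v v1), h5, transp_transp h2 v5 h4 (hT v v2),
      ← transp_transp k1 v5 k3 (hT v v2), k5, transp_transp k2 v6 k4 (hR v v3)]

theorem AbsRel.smul {X : Nom V} (π : FinPerm V) {p q : V × X} (h : AbsRel X p q) :
    AbsRel X (π • p) (π • q) := by
  obtain ⟨z, h1, h2, h3, h4, h5⟩ := h
  refine ⟨π • z, ?_, ?_, h3.smul π, h4.smul π, ?_⟩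
  · exact fun h => h1 (MulAction.injective π h)
  · exact fun h => h2 (MulAction.injective π h)
  · change transp (π • p.1) (π • z) • π • p.2 = transp (π • q.1) (π • z) • π • q.2
    rw [← smul_transp, ← smul_transp, h5]

theorem AbsRel.map {X Y : Nom V} (f : X →[FinPerm V] Y) {p q : V × X} (h : AbsRel X p q) :
    AbsRel Y (p.1, f p.2) (q.1, f q.2) := by
  obtain ⟨z, h1, h2, h3, h4, h5⟩ := h
  refine ⟨z, h1, h2, h3.map f, h4.map f, ?_⟩
  change transp p.1 z • f p.2 = transp q.1 z • f q.2
  rw [← map_smul, ← map_smul, h5]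

variable [Infinite V]

def absSetoid (X : Nom V) : Setoid (V × X) := ⟨AbsRel X, AbsRel.equivalence X⟩

/-- The underlying set of the abstraction `[V]X`. -/
def AbsCarrier (X : Nom V) : Type u := Quotient (absSetoid X)

/-- The class `⟨x⟩u` in `[V]X`. -/
def AbsCarrier.mk {X : Nom V} (x : V) (u : X) : AbsCarrier X := Quotient.mk (absSetoid X) (x, u)

instance (X : Nom V) : MulAction (FinPerm V) (AbsCarrier X) where
  smul π := Quotient.map (fun p : V × X => π • p) (fun _ _ h => AbsRel.smul π h)
  one_smul a := by
    induction a using Quotient.inductionOn with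
    | h p => exact congrArg (Quotient.mk (absSetoid X)) (one_smul _ p)
  mul_smul π σ a := by
    induction a using Quotient.inductionOn with
    | h p => exact congrArg (Quotient.mk (absSetoid X)) (mul_smul π σ p)

theorem AbsCarrier.smul_mk {X : Nom V} (π : FinPerm V) (x : V) (u : X) :
    π • AbsCarrier.mk x u = AbsCarrier.mk (π • x) (π • u) := rfl

/-- The nominal set `[V]X`. -/
def absObj (X : Nom V) : Nom V where
  carrier := AbsCarrier X
  finSupp a := by
    induction a using Quotient.inductionOn with
    | h p =>
      obtain ⟨x, u⟩ := p
      obtain ⟨S, hS⟩ := X.finSupp u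
      refine ⟨insert x S, fun g hg => ?_⟩
      change g • AbsCarrier.mk x u = AbsCarrier.mk x u
      rw [AbsCarrier.smul_mk, hg (by simp), hS g (fun a ha => hg (by simp [ha]))]

/-- `⟨x⟩u` as an element of the nominal set `[V]X`. -/
def absMk {X : Nom V} (x : V) (u : X) : absObj X := AbsCarrier.mk x u

/-- The map `[V]f`, sending `⟨x⟩u` to `⟨x⟩(f u)`. -/
def absMap {X Y : Nom V} (f : X →[FinPerm V] Y) : absObj X →[FinPerm V] absObj Y where
  toFun := Quotient.map (fun p : V × X => (p.1, f p.2)) (fun _ _ h => AbsRel.map f h)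
  map_smul' π a := by
    induction a using Quotient.inductionOn with
    | h p =>
      change AbsCarrier.mk (π • p.1) (f (π • p.2)) = AbsCarrier.mk (π • p.1) (π • f p.2)
      rw [map_smul]

/-- The abstraction functor `[V](-)`. -/
def absFunctor (V : Type u) [DecidableEq V] [Infinite V] : Nom V ⥤ Nom V where
  obj := absObj
  map f := absMap f
  map_id _ := Nom.hom_ext fun a => Quotient.inductionOn a fun _ => rfl
  map_comp _ _ := Nom.hom_ext fun a => Quotient.inductionOn a fun _ => rfl

/-- The `n`-fold iterate `[V]ⁿ(-)`, with `[V]ⁿ⁺¹X = [V]([V]ⁿX)`. -/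
def absPow (V : Type u) [DecidableEq V] [Infinite V] : ℕ → (Nom V ⥤ Nom V)
  | 0 => 𝟭 (Nom V)
  | n + 1 => absPow V n ⋙ absFunctor V

/-- `⟨x₁⟩…⟨xₙ⟩u` in `[V]ⁿX`. -/
def absList {X : Nom V} : (n : ℕ) → (Fin n → V) → X → (absPow V n).obj X
  | 0, _, u => u
  | n + 1, xs, u => absMk (xs 0) (absList n (fun j => xs j.succ) u)

end Abstraction

/-! ### Binding signatures and their functors -/

/-- A binding signature: a set of operations with binding arities `n₁, …, n_k`. -/
structure BindingSig where
  Op : Type u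
  ar : Op → List ℕ

/-- The number `k` of arguments of an operation. -/
abbrev BindingSig.arity (S : BindingSig.{u}) (o : S.Op) : ℕ := (S.ar o).length

/-- The number `nᵢ` of names bound in the `i`-th argument. -/
abbrev BindingSig.binds (S : BindingSig.{u}) (o : S.Op) (i : Fin (S.arity o)) : ℕ := (S.ar o).get i

section Functors

variable (V : Type u) [DecidableEq V] [Infinite V]

/-- The underlying set of `V + ∐_op [V]^{n₁}X × … × [V]^{n_k}X`. -/
abbrev FCarrier (S : BindingSig.{u}) (X : Nom V) : Type u :=
  V ⊕ (Σ o : S.Op, ∀ i : Fin (S.arity o), (absPow V (S.binds o i)).obj X)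

/-- The nominal set `V + ∐_op [V]^{n₁}X × … × [V]^{n_k}X`. -/
def FObj (S : BindingSig.{u}) (X : Nom V) : Nom V where
  carrier := FCarrier V S X
  finSupp a := by
    rcases a with x | ⟨o, w⟩
    · obtain ⟨T, hT⟩ := finSupp_name V x
      exact ⟨T, fun g hg => congrArg Sum.inl (hT g hg)⟩
    · choose T hT using fun i => Nom.finSupp _ (w i)
      refine ⟨Finset.univ.biUnion T, fun g hg => ?_⟩
      refine congrArg (fun w => (Sum.inr ⟨o, w⟩ : FCarrier V S X)) (funext fun i => hT i g fun a ha => hg ?_)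
      simp only [Finset.coe_biUnion, Set.mem_iUnion]
      exact ⟨i, by simp, ha⟩

/-- The functor `F_α X = V + ∐_op [V]^{n₁}X × … × [V]^{n_k}X`. -/
def FFunctor (S : BindingSig.{u}) : Nom V ⥤ Nom V where
  obj := FObj V S
  map {X Y} f :=
    { toFun := fun a : FCarrier V S X => (Sum.map id
        (fun p => ⟨p.1, fun i => Nom.map ((absPow V (S.binds p.1 i)).map f) (p.2 i)⟩) a :
          FCarrier V S Y)
      map_smul' := by
        rintro π (x | ⟨o, w⟩)
        · rfl
        · exact congrArg (fun w => (Sum.inr ⟨o, w⟩ : FCarrier V S Y))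
            (funext fun i => map_smul (Nom.map ((absPow V (S.binds o i)).map f)) π (w i)) }
  map_id X := by
    refine Nom.hom_ext fun a => ?_
    rcases a with x | ⟨o, w⟩
    · rfl
    · refine congrArg (fun w => (Sum.inr ⟨o, w⟩ : FCarrier V S X)) (funext fun i => ?_)
      change Nom.map ((absPow V (S.binds o i)).map (𝟙 X)) (w i) = w i
      rw [CategoryTheory.Functor.map_id]
      rfl
  map_comp {X Y Z} f g := by
    refine Nom.hom_ext fun a => ?_
    rcases a with x | ⟨o, w⟩
    · rfl
    · refine congrArg (fun w => (Sum.inr ⟨o, w⟩ : FCarrier V S Z)) (funext fun i => ?_)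
      change Nom.map ((absPow V (S.binds o i)).map (f ≫ g)) (w i) = _
      rw [CategoryTheory.Functor.map_comp]
      rfl

/-- The underlying set of `V + [V]X + X × X`. -/
abbrev LCarrier (X : Nom V) : Type u := V ⊕ (absObj X ⊕ (X × X))

/-- The nominal set `V + [V]X + X × X`. -/
def LObj (X : Nom V) : Nom V where
  carrier := LCarrier V X
  finSupp a := by
    rcases a with x | a | ⟨u, v⟩
    · obtain ⟨T, hT⟩ := finSupp_name V x
      exact ⟨T, fun g hg => congrArg Sum.inl (hT g hg)⟩
    · obtain ⟨T, hT⟩ := (absObj X).finSupp a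
      exact ⟨T, fun g hg => congrArg (fun a => Sum.inr (Sum.inl a)) (hT g hg)⟩
    · obtain ⟨S, hS⟩ := X.finSupp u
      obtain ⟨T, hT⟩ := X.finSupp v
      refine ⟨S ∪ T, fun g hg => congrArg (fun a => Sum.inr (Sum.inr a)) (Prod.ext ?_ ?_)⟩
      · exact hS g fun a ha => hg (by simp at ha; simp [ha])
      · exact hT g fun a ha => hg (by simp at ha; simp [ha])

/-- The functor `L_α X = V + [V]X + X × X`. -/
def LFunctor : Nom V ⥤ Nom V where
  obj := LObj V
  map {X Y} f :=
    { toFun := fun a : LCarrier V X =>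
        (Sum.map id (Sum.map (absMap f) (Prod.map (Nom.map f) (Nom.map f))) a : LCarrier V Y)
      map_smul' := by
        rintro π (x | a | ⟨u, v⟩)
        · rfl
        · exact congrArg (fun a => (Sum.inr (Sum.inl a) : LCarrier V Y)) (map_smul (absMap f) π a)
        · exact congrArg (fun a => (Sum.inr (Sum.inr a) : LCarrier V Y))
            (Prod.ext (map_smul (Nom.map f) π u) (map_smul (Nom.map f) π v)) }
  map_id X := by
    refine Nom.hom_ext fun a => ?_
    rcases a with x | a | ⟨u, v⟩
    · rfl
    · exact Quotient.inductionOn a fun _ => rfl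
    · rfl
  map_comp f g := by
    refine Nom.hom_ext fun a => ?_
    rcases a with x | a | ⟨u, v⟩
    · rfl
    · exact Quotient.inductionOn a fun _ => rfl
    · rfl

end Functors

/-! ### Finite raw terms with holes, and their α-equivalence -/

section FiniteTerms

/-- Finite raw terms over a binding signature extended with one constant `*`, as they arise by
truncation: names, `*`, and `op(⟨x̄₁⟩.t₁, …, ⟨x̄_k⟩.t_k)` with `x̄ᵢ` a list of `nᵢ` names. -/
inductive FinTerm (V : Type u) (S : BindingSig.{u}) : Type u
  | star : FinTerm V S
  | var (x : V) : FinTerm V S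
  | op (o : S.Op) (xs : ∀ i : Fin (S.arity o), Fin (S.binds o i) → V)
      (ts : Fin (S.arity o) → FinTerm V S) : FinTerm V S

variable {V : Type u} {S : BindingSig.{u}}

/-- All names occurring in a term, in binding position or not. -/
def FinTerm.names : FinTerm V S → Set V
  | .star => ∅
  | .var x => {x}
  | .op _ xs ts => ⋃ i, (Set.range (xs i) ∪ (ts i).names)

/-- The free variables of a term: `op` binds the names `x̄ᵢ` in `tᵢ`. -/
def FinTerm.fv : FinTerm V S → Set V
  | .star => ∅
  | .var x => {x}
  | .op _ xs ts => ⋃ i, ((ts i).fv \ Set.range (xs i))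

theorem FinTerm.names_finite (t : FinTerm V S) : t.names.Finite := by
  induction t with
  | star => exact Set.finite_empty
  | var x => exact Set.finite_singleton x
  | op o xs ts ih => exact Set.finite_iUnion fun i => (Set.finite_range _).union (ih i)

theorem FinTerm.fv_subset_names (t : FinTerm V S) : t.fv ⊆ t.names := by
  induction t with
  | star => exact subset_rfl
  | var x => exact subset_rfl
  | op o xs ts ih => exact Set.iUnion_mono fun i a ha => Or.inr (ih i ha.1)

theorem exists_fresh_list [Infinite V] {A : Set V} (hA : A.Finite) (n : ℕ) :
    ∃ zs : Fin n → V, Function.Injective zs ∧ ∀ j, zs j ∉ A := by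
  have := hA.infinite_compl.to_subtype
  let e := Infinite.natEmbedding (Aᶜ : Set V)
  exact ⟨fun j => (e j : V), fun a b h => Fin.ext (e.injective (Subtype.ext h)),
    fun j => (e j).2⟩

theorem FinTerm.names_arg {o : S.Op} {xs : ∀ i : Fin (S.arity o), Fin (S.binds o i) → V}
    {ts : Fin (S.arity o) → FinTerm V S} {z : V} (h : z ∉ (FinTerm.op o xs ts).names)
    (i : Fin (S.arity o)) : (∀ j, z ≠ xs i j) ∧ z ∉ (ts i).names :=
  ⟨fun j hj => h (Set.mem_iUnion.2 ⟨i, Or.inl ⟨j, hj.symm⟩⟩),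
    fun hz => h (Set.mem_iUnion.2 ⟨i, Or.inr hz⟩)⟩

variable [DecidableEq V]

/-- The permutation action on terms, acting on all names. -/
def FinTerm.act (π : FinPerm V) : FinTerm V S → FinTerm V S
  | .star => .star
  | .var x => .var (π • x)
  | .op o xs ts => .op o (fun i j => π • xs i j) (fun i => (ts i).act π)

instance : MulAction (FinPerm V) (FinTerm V S) where
  smul π t := t.act π
  one_smul t := by
    change t.act 1 = t
    induction t with
    | star => rfl
    | var x => rfl
    | op o xs ts ih => simp only [FinTerm.act, one_smul, ih]
  mul_smul π σ t := by
    change t.act (π * σ) = (t.act σ).act π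
    induction t with
    | star => rfl
    | var x => rfl
    | op o xs ts ih => simp only [FinTerm.act, mul_smul, ih]

theorem FinTerm.smul_star (π : FinPerm V) : π • (.star : FinTerm V S) = .star := rfl

theorem FinTerm.smul_var (π : FinPerm V) (x : V) :
    π • (.var x : FinTerm V S) = .var (π • x) := rfl

theorem FinTerm.smul_op (π : FinPerm V) (o : S.Op)
    (xs : ∀ i : Fin (S.arity o), Fin (S.binds o i) → V) (ts : Fin (S.arity o) → FinTerm V S) :
    π • FinTerm.op o xs ts = .op o (fun i j => π • xs i j) (fun i => π • ts i) := rfl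

/-- The permutation `(x̄ z̄)`, i.e. the composition `(x₁ z₁) ⋯ (xₙ zₙ)`. -/
def listTransp : {n : ℕ} → (Fin n → V) → (Fin n → V) → FinPerm V
  | 0, _, _ => 1
  | _ + 1, xs, zs => transp (xs 0) (zs 0) * listTransp (fun j => xs j.succ) (fun j => zs j.succ)

/-- α-equivalence of finite terms. -/
inductive FinTerm.Alpha : FinTerm V S → FinTerm V S → Prop
  | star : Alpha .star .star
  | var (x : V) : Alpha (.var x) (.var x)
  | op (o : S.Op) (xs ys zs : ∀ i : Fin (S.arity o), Fin (S.binds o i) → V)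
      (ts ss : Fin (S.arity o) → FinTerm V S)
      (distinct : ∀ i, Function.Injective (zs i))
      (fresh : ∀ i j, zs i j ∉ (FinTerm.op o xs ts).names ∧ zs i j ∉ (FinTerm.op o ys ss).names)
      (args : ∀ i, Alpha (listTransp (xs i) (zs i) • ts i) (listTransp (ys i) (zs i) • ss i)) :
      Alpha (.op o xs ts) (.op o ys ss)

theorem FinTerm.smul_congr {t : FinTerm V S} {π σ : FinPerm V}
    (h : ∀ a ∈ t.names, π • a = σ • a) : π • t = σ • t := by
  induction t with
  | star => rfl
  | var x => rw [smul_var, smul_var, h x rfl]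
  | op o xs ts ih =>
    have h1 : ∀ i j, π • xs i j = σ • xs i j := fun i j =>
      h _ (Set.mem_iUnion.2 ⟨i, Or.inl ⟨j, rfl⟩⟩)
    have h2 : ∀ i, π • ts i = σ • ts i := fun i =>
      ih i fun a ha => h a (Set.mem_iUnion.2 ⟨i, Or.inr ha⟩)
    simp only [smul_op, h1, h2]

theorem FinTerm.names_smul (π : FinPerm V) (t : FinTerm V S) :
    (π • t).names = (fun a => π • a) '' t.names := by
  induction t with
  | star => simp [smul_star, names]
  | var x => simp [smul_var, names]
  | op o xs ts ih =>
    simp only [smul_op, names, ih, Set.image_iUnion, Set.image_union, ← Set.range_comp]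
    rfl

theorem FinTerm.fv_smul (π : FinPerm V) (t : FinTerm V S) :
    (π • t).fv = (fun a => π • a) '' t.fv := by
  induction t with
  | star => simp [smul_star, fv]
  | var x => simp [smul_var, fv]
  | op o xs ts ih =>
    simp only [smul_op, fv, ih, Set.image_iUnion,
      Set.image_sdiff (MulAction.injective π), ← Set.range_comp]
    rfl

theorem smul_listTransp (π : FinPerm V) {n : ℕ} (xs zs : Fin n → V) :
    π * listTransp xs zs = listTransp (fun j => π • xs j) (fun j => π • zs j) * π := by
  induction n with
  | zero => simp [listTransp]
  | succ n ih =>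
    have h : π * transp (xs 0) (zs 0) = transp (π • xs 0) (π • zs 0) * π :=
      Subtype.ext (Equiv.mul_swap_eq_swap_mul π.1 (xs 0) (zs 0))
    simp only [listTransp]
    rw [← mul_assoc, h, mul_assoc, ih, mul_assoc]

theorem transp_smul_of_ne {x z a : V} (h1 : a ≠ x) (h2 : a ≠ z) : transp x z • a = a :=
  Equiv.swap_apply_of_ne_of_ne h1 h2

theorem listTransp_fix {n : ℕ} {xs zs : Fin n → V} {a : V} (hx : ∀ j, a ≠ xs j)
    (hz : ∀ j, a ≠ zs j) : listTransp xs zs • a = a := by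
  induction n with
  | zero => simp [listTransp]
  | succ n ih =>
    rw [listTransp, mul_smul, ih (fun j => hx _) (fun j => hz _),
      transp_smul_of_ne (hx 0) (hz 0)]

theorem listTransp_last {n : ℕ} {xs zs : Fin n → V} (hz : Function.Injective zs)
    (hd : ∀ i j, zs i ≠ xs j) (j : Fin n) (hj : ∀ k, j < k → xs k ≠ xs j) :
    listTransp xs zs • xs j = zs j := by
  induction n with
  | zero => exact j.elim0
  | succ n ih =>
    rw [listTransp, mul_smul]
    refine Fin.cases ?_ (fun j hj => ?_) j hj
    · intro hj
      rw [listTransp_fix (fun k => (hj k.succ (Fin.succ_pos k)).symm) (fun k => (hd k.succ 0).symm)]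
      exact Equiv.swap_apply_left _ _
    · rw [ih (xs := fun j => xs j.succ) (zs := fun j => zs j.succ)
        (fun a b h => Fin.succ_injective _ (hz h)) (fun _ _ => hd _ _) j
        (fun k hk => hj k.succ (Fin.succ_lt_succ_iff.2 hk))]
      exact transp_smul_of_ne (hd _ _) (fun h => Fin.succ_ne_zero j (hz h))

theorem exists_last {n : ℕ} {xs : Fin n → V} {a : V} (h : ∃ j, xs j = a) :
    ∃ j, xs j = a ∧ ∀ k, j < k → xs k ≠ xs j := by
  have hne : (Finset.univ.filter fun j => xs j = a).Nonempty := by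
    obtain ⟨j, hj⟩ := h
    exact ⟨j, by simpa using hj⟩
  refine ⟨Finset.max' _ hne, ?_, fun k hk hxk => ?_⟩
  · have := Finset.max'_mem _ hne
    simpa using this
  · have h1 := Finset.max'_mem _ hne
    have h2 : xs (Finset.max' _ hne) = a := by simpa using h1
    exact absurd (Finset.le_max' _ k (by simpa using hxk.trans h2)) (not_le.2 hk)

/-- Permutations that agree on the free variables yield α-equivalent terms. -/
theorem FinTerm.Alpha.of_agree [Infinite V] {t : FinTerm V S} {π σ : FinPerm V}
    (h : ∀ a ∈ t.fv, π • a = σ • a) : Alpha (π • t) (σ • t) := by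
  induction t generalizing π σ with
  | star => exact .star
  | var x =>
    rw [smul_var, smul_var, h x rfl]
    exact .var _
  | op o xs ts ih =>
    choose zs hinj hfresh using fun i : Fin (S.arity o) =>
      exists_fresh_list ((π • FinTerm.op o xs ts).names_finite.union
        (σ • FinTerm.op o xs ts).names_finite) (S.binds o i)
    have hfr : ∀ i j, zs i j ∉ (π • FinTerm.op o xs ts).names ∧
        zs i j ∉ (σ • FinTerm.op o xs ts).names := fun i j =>
      ⟨fun h => hfresh i j (Or.inl h), fun h => hfresh i j (Or.inr h)⟩
    refine .op o _ _ zs _ _ hinj hfr fun i => ?_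
    change Alpha (_ • π • ts i) (_ • σ • ts i)
    rw [smul_smul, smul_smul]
    refine ih i fun a ha => ?_
    rw [mul_smul, mul_smul]
    have hπ := fun j => names_arg (hfr i j).1 i
    have hσ := fun j => names_arg (hfr i j).2 i
    by_cases hax : ∃ j, xs i j = a
    · obtain ⟨j, rfl, hj⟩ := exists_last hax
      rw [listTransp_last (xs := fun j => π • xs i j) (hinj i) (fun k l => (hπ k).1 l) j
          (fun k hk hh => hj k hk (MulAction.injective π hh)),
        listTransp_last (xs := fun j => σ • xs i j) (hinj i) (fun k l => (hσ k).1 l) j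
          (fun k hk hh => hj k hk (MulAction.injective σ hh))]
    · have hab : π • a = σ • a := h a (Set.mem_iUnion.2 ⟨i, ha, fun ⟨j, hj⟩ => hax ⟨j, hj⟩⟩)
      have hn : π • a ∈ (π • ts i).names := by
        rw [names_smul]
        exact ⟨a, fv_subset_names _ ha, rfl⟩
      have hne : ∀ j, π • a ≠ zs i j := fun j hh => (hπ j).2 (hh ▸ hn)
      rw [listTransp_fix (fun j (hh : π • a = π • xs i j) =>
          hax ⟨j, (MulAction.injective π hh).symm⟩) hne, hab,
        listTransp_fix (fun j (hh : σ • a = σ • xs i j) =>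
          hax ⟨j, (MulAction.injective σ hh).symm⟩)
          (fun j => hab ▸ hne j)]

theorem FinTerm.Alpha.refl [Infinite V] (t : FinTerm V S) : Alpha t t := by
  have := Alpha.of_agree (t := t) (π := 1) (σ := 1) (fun _ _ => rfl)
  rwa [one_smul] at this

theorem FinTerm.Alpha.symm {t s : FinTerm V S} (h : Alpha t s) : Alpha s t := by
  induction h with
  | star => exact .star
  | var x => exact .var x
  | op o xs ys zs ts ss hd hf _ ih => exact .op o ys xs zs ss ts hd (fun i j => (hf i j).symm) ih

theorem FinTerm.Alpha.smul (π : FinPerm V) {t s : FinTerm V S} (h : Alpha t s) :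
    Alpha (π • t) (π • s) := by
  induction h with
  | star => exact .star
  | var x => exact .var _
  | op o xs ys zs ts ss hd hf _ ih =>
    refine .op o _ _ (fun i j => π • zs i j) _ _
      (fun i a b hab => hd i (MulAction.injective π hab)) (fun i j => ?_) (fun i => ?_)
    · constructor
      · change _ ∉ (π • FinTerm.op o xs ts).names
        rw [names_smul]
        rintro ⟨a, ha, hh⟩
        exact (hf i j).1 (MulAction.injective π hh ▸ ha)
      · change _ ∉ (π • FinTerm.op o ys ss).names
        rw [names_smul]
        rintro ⟨a, ha, hh⟩
        exact (hf i j).2 (MulAction.injective π hh ▸ ha)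
    · have := ih i
      rw [smul_smul, smul_smul, smul_listTransp, smul_listTransp, mul_smul, mul_smul] at this
      exact this

theorem listTransp_listTransp {n : ℕ} {xs zs vs : Fin n → V} {t : FinTerm V S}
    (hz : Function.Injective zs) (hv : Function.Injective vs)
    (hzx : ∀ i, (∀ j, zs i ≠ xs j) ∧ zs i ∉ t.names)
    (hvx : ∀ i, (∀ j, vs i ≠ xs j) ∧ vs i ∉ t.names) (hvz : ∀ i j, vs i ≠ zs j) :
    listTransp zs vs • listTransp xs zs • t = listTransp xs vs • t := by
  rw [smul_smul]
  refine FinTerm.smul_congr fun a ha => ?_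
  rw [mul_smul]
  by_cases hax : ∃ j, xs j = a
  · obtain ⟨j, rfl, hj⟩ := exists_last hax
    rw [listTransp_last hz (fun k l => (hzx k).1 l) j hj,
      listTransp_last hv (fun k l => (hvx k).1 l) j hj,
      listTransp_last hv hvz j (fun k hk hh => hk.ne' (hz hh))]
  · have h1 : ∀ j, a ≠ xs j := fun j hh => hax ⟨j, hh.symm⟩
    have h2 : ∀ j, a ≠ zs j := fun j hh => (hzx j).2 (hh ▸ ha)
    have h3 : ∀ j, a ≠ vs j := fun j hh => (hvx j).2 (hh ▸ ha)
    rw [listTransp_fix h1 h2, listTransp_fix h2 h3, listTransp_fix h1 h3]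

theorem FinTerm.Alpha.trans [Infinite V] {t s r : FinTerm V S} (h : Alpha t s) (h' : Alpha s r) :
    Alpha t r := by
  induction h generalizing r with
  | star => exact h'
  | var x => exact h'
  | op o xs ys zs ts ss hd hf _ ih =>
    cases h' with
    | op _ _ us ws _ rs kd kf kargs =>
      have hA : ((FinTerm.op o xs ts).names ∪ (FinTerm.op o ys ss).names ∪
          (FinTerm.op o us rs).names ∪ (⋃ i, Set.range (zs i)) ∪
          (⋃ i, Set.range (ws i))).Finite :=
        ((((names_finite _).union (names_finite _)).union (names_finite _)).union
          (Set.finite_iUnion fun i => Set.finite_range _)).union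
          (Set.finite_iUnion fun i => Set.finite_range _)
      choose vs vinj vfresh using fun i : Fin (S.arity o) => exists_fresh_list hA (S.binds o i)
      simp only [Set.mem_union, not_or, Set.mem_iUnion, not_exists, Set.mem_range] at vfresh
      refine .op o _ _ vs _ _ vinj
        (fun i j => ⟨(vfresh i j).1.1.1.1, (vfresh i j).1.1.2⟩) (fun i => ?_)
      have hvz : ∀ a b, vs i a ≠ zs i b := fun a b hh => (vfresh i a).1.2 i b hh.symm
      have hvw : ∀ a b, vs i a ≠ ws i b := fun a b hh => (vfresh i a).2 i b hh.symm
      have ex := listTransp_listTransp (hd i) (vinj i) (fun j => names_arg (hf i j).1 i)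
        (fun j => names_arg (vfresh i j).1.1.1.1 i) hvz
      have ey := listTransp_listTransp (hd i) (vinj i) (fun j => names_arg (hf i j).2 i)
        (fun j => names_arg (vfresh i j).1.1.1.2 i) hvz
      have ey' := listTransp_listTransp (kd i) (vinj i) (fun j => names_arg (kf i j).1 i)
        (fun j => names_arg (vfresh i j).1.1.1.2 i) hvw
      have eu := listTransp_listTransp (kd i) (vinj i) (fun j => names_arg (kf i j).2 i)
        (fun j => names_arg (vfresh i j).1.1.2 i) hvw
      have h1 := (kargs i).smul (listTransp (ws i) (vs i))
      rw [ey', eu, ← ey] at h1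
      have h2 := h1.smul (listTransp (zs i) (vs i))⁻¹
      rw [inv_smul_smul] at h2
      have h3 := (ih i h2).smul (listTransp (zs i) (vs i))
      rwa [ex, smul_inv_smul] at h3

end FiniteTerms

/-! ### Infinitary raw terms -/

section InfinitaryTerms

/-- The polynomial functor `X ↦ V + ∐_op (V^{n₁} × X) × … × (V^{n_k} × X)` on sets. -/
def rawFunctor (V : Type u) (S : BindingSig.{u}) : PFunctor.{u, 0} where
  A := V ⊕ (Σ o : S.Op, ∀ i : Fin (S.arity o), Fin (S.binds o i) → V)
  B := Sum.elim (fun _ => Empty) (fun a => Fin (S.arity a.1))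

/-- Infinitary raw terms: the final coalgebra of `rawFunctor V S`. -/
def RawTerm (V : Type u) (S : BindingSig.{u}) : Type u := (rawFunctor V S).M

variable {V : Type u} {S : BindingSig.{u}}

/-- The one-step unfolding of a raw term. -/
def RawTerm.dest (t : RawTerm V S) : rawFunctor V S (RawTerm V S) := PFunctor.M.dest t

/-- A name as a raw term. -/
def RawTerm.var (x : V) : RawTerm V S :=
  PFunctor.M.mk (F := rawFunctor V S) ⟨Sum.inl x, Empty.elim⟩

/-- The raw term `op(⟨x̄₁⟩.t₁, …, ⟨x̄_k⟩.t_k)`. -/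
def RawTerm.op (o : S.Op) (xs : ∀ i : Fin (S.arity o), Fin (S.binds o i) → V)
    (ts : Fin (S.arity o) → RawTerm V S) : RawTerm V S :=
  PFunctor.M.mk (F := rawFunctor V S) ⟨Sum.inr ⟨o, xs⟩, ts⟩

theorem RawTerm.var_or_op (t : RawTerm V S) :
    (∃ x, t = .var x) ∨ ∃ o xs ts, t = .op o xs ts := by
  rcases h : PFunctor.M.dest (F := rawFunctor V S) t with ⟨x | ⟨o, xs⟩, ts⟩
  · refine Or.inl ⟨x, ?_⟩
    rw [RawTerm.var, ← PFunctor.M.mk_dest (F := rawFunctor V S) t, h]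
    congr 2
    exact funext fun e => Empty.elim e
  · exact Or.inr ⟨o, xs, ts, (PFunctor.M.mk_dest (F := rawFunctor V S) t).symm.trans
      (congrArg PFunctor.M.mk h)⟩

/-- The truncation `tⁿ` of a raw term at depth `n`. -/
def RawTerm.trunc : ℕ → RawTerm V S → FinTerm V S
  | 0, _ => .star
  | n + 1, t =>
    match t.dest with
    | ⟨Sum.inl x, _⟩ => .var x
    | ⟨Sum.inr ⟨o, xs⟩, ts⟩ => .op o xs (fun i => RawTerm.trunc n (ts i))

theorem RawTerm.trunc_var (n : ℕ) (x : V) : (var x : RawTerm V S).trunc (n + 1) = .var x := rfl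

theorem RawTerm.trunc_op (n : ℕ) (o : S.Op) (xs : ∀ i : Fin (S.arity o), Fin (S.binds o i) → V)
    (ts : Fin (S.arity o) → RawTerm V S) :
    (op o xs ts).trunc (n + 1) = .op o xs (fun i => (ts i).trunc n) := rfl

/-- The free variables of an infinitary raw term. -/
def RawTerm.fv (t : RawTerm V S) : Set V := ⋃ n, (t.trunc n).fv

theorem RawTerm.fv_var (x : V) : (var x : RawTerm V S).fv = {x} := by
  refine Set.Subset.antisymm (Set.iUnion_subset fun n => ?_) (Set.subset_iUnion_of_subset 1 ?_)
  · cases n with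
    | zero => exact Set.empty_subset _
    | succ n => exact subset_rfl
  · exact subset_rfl

theorem RawTerm.fv_op (o : S.Op) (xs : ∀ i : Fin (S.arity o), Fin (S.binds o i) → V)
    (ts : Fin (S.arity o) → RawTerm V S) :
    (op o xs ts).fv = ⋃ i, ((ts i).fv \ Set.range (xs i)) := by
  refine Set.Subset.antisymm (Set.iUnion_subset fun n => ?_) (Set.iUnion_subset fun i => ?_)
  · cases n with
    | zero => exact Set.empty_subset _
    | succ n =>
      rw [trunc_op]
      exact Set.iUnion_mono fun i =>
        Set.sdiff_subset_sdiff_left (Set.subset_iUnion (fun n => ((ts i).trunc n).fv) n)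
  · rintro a ⟨ha, hx⟩
    obtain ⟨n, hn⟩ := Set.mem_iUnion.1 ha
    refine Set.mem_iUnion.2 ⟨n + 1, ?_⟩
    rw [trunc_op]
    exact Set.mem_iUnion.2 ⟨i, hn, hx⟩

theorem RawTerm.bisim (R : RawTerm V S → RawTerm V S → Prop)
    (h : ∀ t s, R t s → (∃ x, t = .var x ∧ s = .var x) ∨
      ∃ o xs ts ss, t = .op o xs ts ∧ s = .op o xs ss ∧ ∀ i, R (ts i) (ss i))
    (t s : RawTerm V S) (hts : R t s) : t = s := by
  refine PFunctor.M.bisim (P := rawFunctor V S) R (fun t s hts => ?_) t s hts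
  rcases h t s hts with ⟨x, rfl, rfl⟩ | ⟨o, xs, ts, ss, rfl, rfl, hR⟩
  · exact ⟨_, _, _, rfl, rfl, fun e => Empty.elim e⟩
  · exact ⟨_, _, _, rfl, rfl, hR⟩

variable [DecidableEq V]

/-- One step of the coinductive definition of the permutation action. -/
def RawTerm.actStep (π : FinPerm V) (t : RawTerm V S) : rawFunctor V S (RawTerm V S) :=
  match t.dest with
  | ⟨Sum.inl x, _⟩ => ⟨Sum.inl (π • x), Empty.elim⟩
  | ⟨Sum.inr ⟨o, xs⟩, ts⟩ => ⟨Sum.inr ⟨o, fun i j => π • xs i j⟩, ts⟩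

/-- The permutation action on raw terms, defined coinductively. -/
def RawTerm.act (π : FinPerm V) : RawTerm V S → RawTerm V S := PFunctor.M.corec (actStep π)

theorem RawTerm.act_var (π : FinPerm V) (x : V) :
    (var x : RawTerm V S).act π = .var (π • x) := by
  rw [act, PFunctor.M.corec_def, var]
  refine congrArg PFunctor.M.mk (Sigma.ext rfl (heq_of_eq ?_))
  exact funext fun e => Empty.elim e

theorem RawTerm.act_op (π : FinPerm V) (o : S.Op)
    (xs : ∀ i : Fin (S.arity o), Fin (S.binds o i) → V) (ts : Fin (S.arity o) → RawTerm V S) :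
    (op o xs ts).act π = .op o (fun i j => π • xs i j) (fun i => (ts i).act π) := by
  rw [act, PFunctor.M.corec_def, op]
  rfl

instance : MulAction (FinPerm V) (RawTerm V S) where
  smul π t := t.act π
  one_smul t := by
    change t.act 1 = t
    refine RawTerm.bisim (fun t s => t = s.act 1) ?_ _ _ rfl
    rintro _ s rfl
    rcases s.var_or_op with ⟨x, rfl⟩ | ⟨o, xs, ts, rfl⟩
    · exact Or.inl ⟨x, by rw [RawTerm.act_var, one_smul], rfl⟩
    · exact Or.inr ⟨o, xs, fun i => (ts i).act 1, ts,
        by simp only [RawTerm.act_op, one_smul], rfl, fun i => rfl⟩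
  mul_smul π σ t := by
    change t.act (π * σ) = (t.act σ).act π
    refine RawTerm.bisim (fun t s => ∃ r : RawTerm V S, t = r.act (π * σ) ∧ s = (r.act σ).act π)
      ?_ _ _ ⟨t, rfl, rfl⟩
    rintro _ _ ⟨r, rfl, rfl⟩
    rcases r.var_or_op with ⟨x, rfl⟩ | ⟨o, xs, ts, rfl⟩
    · exact Or.inl ⟨π • σ • x, by rw [RawTerm.act_var, mul_smul],
        by rw [RawTerm.act_var, RawTerm.act_var]⟩
    · exact Or.inr ⟨o, fun i j => π • σ • xs i j, fun i => (ts i).act (π * σ),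
        fun i => ((ts i).act σ).act π, by simp only [RawTerm.act_op, mul_smul],
        by rw [RawTerm.act_op, RawTerm.act_op], fun i => ⟨ts i, rfl, rfl⟩⟩

theorem RawTerm.smul_var (π : FinPerm V) (x : V) :
    π • (.var x : RawTerm V S) = .var (π • x) := act_var π x

theorem RawTerm.smul_op (π : FinPerm V) (o : S.Op)
    (xs : ∀ i : Fin (S.arity o), Fin (S.binds o i) → V) (ts : Fin (S.arity o) → RawTerm V S) :
    π • RawTerm.op o xs ts = .op o (fun i j => π • xs i j) (fun i => π • ts i) := act_op π o xs ts

theorem RawTerm.trunc_smul (π : FinPerm V) (n : ℕ) (t : RawTerm V S) :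
    (π • t).trunc n = π • t.trunc n := by
  induction n generalizing t with
  | zero => rfl
  | succ n ih =>
    rcases t.var_or_op with ⟨x, rfl⟩ | ⟨o, xs, ts, rfl⟩
    · rw [smul_var, trunc_var, trunc_var, FinTerm.smul_var]
    · rw [smul_op, trunc_op, trunc_op, FinTerm.smul_op]
      simp only [ih]

theorem RawTerm.fv_smul (π : FinPerm V) (t : RawTerm V S) :
    (π • t).fv = (fun a => π • a) '' t.fv := by
  simp only [fv, trunc_smul, FinTerm.fv_smul, Set.image_iUnion]

/-- Infinitary raw terms are α-equivalent if all their truncations are. -/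
def RawTerm.Alpha (t s : RawTerm V S) : Prop := ∀ n, (t.trunc n).Alpha (s.trunc n)

/-- Infinitary raw terms with finitely many free variables. -/
def FfvTerm (V : Type u) (S : BindingSig.{u}) : Type u := {t : RawTerm V S // t.fv.Finite}

/-- A name as a term with finitely many free variables. -/
def FfvTerm.var (x : V) : FfvTerm V S :=
  ⟨RawTerm.var x, by rw [RawTerm.fv_var]; exact Set.finite_singleton x⟩

/-- The term `op(⟨x̄₁⟩.t₁, …, ⟨x̄_k⟩.t_k)` for terms `tᵢ` with finitely many free variables. -/
def FfvTerm.op (o : S.Op) (xs : ∀ i : Fin (S.arity o), Fin (S.binds o i) → V)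
    (ts : Fin (S.arity o) → FfvTerm V S) : FfvTerm V S :=
  ⟨RawTerm.op o xs (fun i => (ts i).1), by
    rw [RawTerm.fv_op]
    exact Set.finite_iUnion fun i => (ts i).2.sdiff⟩

instance : MulAction (FinPerm V) (FfvTerm V S) where
  smul π t := ⟨π • t.1, by rw [RawTerm.fv_smul]; exact t.2.image _⟩
  one_smul t := Subtype.ext (one_smul _ t.1)
  mul_smul π σ t := Subtype.ext (mul_smul π σ t.1)

variable (V S) [Infinite V]

/-- α-equivalence on infinitary raw terms with finitely many free variables. -/
def alphaSetoid : Setoid (FfvTerm V S) where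
  r t s := t.1.Alpha s.1
  iseqv :=
    { refl := fun _ _ => .refl _
      symm := fun h n => (h n).symm
      trans := fun h k n => (h n).trans (k n) }

/-- The set of α-equivalence classes of infinitary raw terms with finitely many free variables. -/
def AlphaCarrier : Type u := Quotient (alphaSetoid V S)

/-- The permutation action `π · [t] = [π · t]`. -/
instance : MulAction (FinPerm V) (AlphaCarrier V S) where
  smul π := Quotient.map (fun t => π • t) (fun t s h n => by
    change ((π • t.1).trunc n).Alpha ((π • s.1).trunc n)
    rw [RawTerm.trunc_smul, RawTerm.trunc_smul]
    exact (h n).smul π)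
  one_smul a := by
    induction a using Quotient.inductionOn with
    | h t => exact congrArg (Quotient.mk (alphaSetoid V S)) (one_smul _ t)
  mul_smul π σ a := by
    induction a using Quotient.inductionOn with
    | h t => exact congrArg (Quotient.mk (alphaSetoid V S)) (mul_smul π σ t)

/-- The nominal set of α-equivalence classes of infinitary raw terms with finitely many free
variables. -/
def alphaTerms : Nom V where
  carrier := AlphaCarrier V S
  finSupp a := by
    induction a using Quotient.inductionOn with
    | h t =>
      refine ⟨t.2.toFinset, fun g hg => ?_⟩
      change Quotient.mk (alphaSetoid V S) (g • t) = Quotient.mk (alphaSetoid V S) t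
      refine Quotient.sound fun n => ?_
      change ((g • t.1).trunc n).Alpha (t.1.trunc n)
      have h := FinTerm.Alpha.of_agree (t := t.1.trunc n) (π := g) (σ := 1) fun a ha => by
        rw [one_smul]
        exact hg (t.2.mem_toFinset.2 (Set.mem_iUnion.2 ⟨n, ha⟩))
      rwa [one_smul, ← RawTerm.trunc_smul] at h

variable {V S}

/-- The α-equivalence class `[t]` of `t`. -/
def alphaMk (t : FfvTerm V S) : alphaTerms V S := Quotient.mk (alphaSetoid V S) t

end InfinitaryTerms

/-! ### The λ-calculus -/

section Lambda

/-- The operations of the λ-calculus: abstraction and application. -/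
inductive LamOp : Type u
  | abs
  | app

/-- The binding signature of the λ-calculus: `ar(abs) = 1` and `ar(app) = 0, 0`. -/
def lamSig : BindingSig.{u} where
  Op := LamOp
  ar
    | .abs => [1]
    | .app => [0, 0]

theorem lamSig_binds_app (i : Fin (lamSig.{u}.arity LamOp.app)) :
    lamSig.{u}.binds LamOp.app i = 0 := by
  match i with
  | ⟨0, _⟩ => rfl
  | ⟨1, _⟩ => rfl

variable {V : Type u}

/-- The λ-term `λx.M`. -/
def lam (x : V) (M : FfvTerm V lamSig) : FfvTerm V lamSig :=
  FfvTerm.op (S := lamSig.{u}) LamOp.abs.{u} (fun _ _ => x) (fun _ => M)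

/-- The λ-term `M N`. -/
def app (M N : FfvTerm V lamSig) : FfvTerm V lamSig :=
  FfvTerm.op (S := lamSig.{u}) LamOp.app.{u}
    (fun i j => (Fin.cast (lamSig_binds_app.{u} i) j).elim0) ![M, N]

end Lambda

end NominalData

open NominalData

/-! Both α-equivalence and equality in `[V]ⁿX` compare bodies after the bound names have been
replaced by fresh ones, and neither comparison depends on which fresh names are used. For terms,
"fresh" may be weakened from "not occurring at all" to "not free": permutations that agree on the
free variables of a finite term give α-equivalent results (`FinTerm.Alpha.of_agree`). This weakening
is essential, since an infinitary term may use up every name in V, leaving none that does not occur.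
Finitely many free variables always leave some, and one list of them serves all truncation depths at
once (`RawTerm.Alpha.op_iff`). Hence two classes with the same head are equal iff their tuples of
abstractions are (`alphaMk_op_eq_iff`), so the structure map is well defined; equivariance follows.

Existence: given a coalgebra on X, choose a representative of every abstraction and unfold
corecursively to a raw term. A name fresh for a state is never free in its unfolding, so the free
variables are finite in number (`Fresh.notMem_fv_unfoldRaw`). The choices are not equivariant, but
their effect vanishes up to α (`unfoldRaw_smul_trunc`), so passing to classes gives an equivariant
map.

Uniqueness: α-equivalence is tested on truncations, so two coalgebra morphisms are compared by
induction on the depth. Renaming all binders to common fresh names turns equality of abstractions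
into equality of bodies, to which the induction hypothesis applies
(`trunc_alpha_of_comp_alphaDest`).

The λ-calculus follows because its signature functor is naturally isomorphic to `LFunctor V`. -/

namespace NominalData

/-! ### Abstractions over names and lists of names -/

section Abstraction

variable {V : Type u} [DecidableEq V]

theorem Fresh.of_supports {X : Type*} [MulAction (FinPerm V) X] {S : Finset V} {u : X}
    (h : MulAction.Supports (FinPerm V) (S : Set V) u) {z : V} (hz : z ∉ S) : Fresh z u :=
  (fresh_iff z u).2 ⟨S, h, hz⟩

variable [Infinite V]

/-- The some/any property of fresh names: `AbsRel` provides some witness `w`, and the swap of `w`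
and `z` turns it into the given `z`. -/
theorem absMk_eq_iff {X : Nom V} {x y z : V} {u v : X} (hx : z ≠ x) (hy : z ≠ y)
    (hu : Fresh z u) (hv : Fresh z v) :
    absMk x u = absMk y v ↔ transp x z • u = transp y z • v := by
  constructor
  · intro h
    obtain ⟨w, h1, h2, h3, h4, h5⟩ : AbsRel X (x, u) (y, v) := Quotient.exact h
    change transp x w • u = transp y w • v at h5
    rw [← transp_transp h1 hx h3 hu, h5, transp_transp h2 hy h4 hv]
  · intro h
    exact Quotient.sound (s := absSetoid X) ⟨z, hx, hy, hu, hv, h⟩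

theorem exists_fresh_name {X Y : Nom V} (u : X) (v : Y) (A : Finset V) :
    ∃ z, Fresh z u ∧ Fresh z v ∧ z ∉ A := by
  obtain ⟨S, hS⟩ := (X.finSupp u).exists_finset
  obtain ⟨T, hT⟩ := (Y.finSupp v).exists_finset
  obtain ⟨z, hz⟩ := Infinite.exists_notMem_finset (S ∪ T ∪ A)
  simp only [Finset.mem_union, not_or] at hz
  exact ⟨z, hS z hz.1.1, hT z hz.1.2, hz.2⟩

theorem absMk_injective {X : Nom V} (x : V) : Function.Injective (absMk (X := X) x) := by
  intro u v h
  obtain ⟨z, hu, hv, hz⟩ := exists_fresh_name u v {x}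
  rw [Finset.mem_singleton] at hz
  exact MulAction.injective _ ((absMk_eq_iff hz hz hu hv).1 h)

theorem smul_absMk {X : Nom V} (π : FinPerm V) (x : V) (u : X) :
    π • absMk x u = absMk (π • x) (π • u) := rfl

theorem Fresh.absMk {X : Nom V} {z x : V} {u : X} (hx : z ≠ x) (hu : Fresh z u) :
    Fresh z (absMk x u) := by
  obtain ⟨S, hS, hz⟩ := (fresh_iff z u).1 hu
  refine Fresh.of_supports (S := insert x S) (fun g hg => ?_) (by simp [hx, hz])
  rw [smul_absMk, hg (by simp), hS g (fun a ha => hg (by simp [ha]))]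

/-- For `w` fresh for `u`, the swap of `z` and `w` fixes the abstraction and the binder `x`, hence
also the body `u`, by injectivity of `absMk x`. It carries freshness of `w` over to `z`. -/
theorem Fresh.of_absMk {X : Nom V} {z x : V} {u : X} (hx : z ≠ x)
    (h : Fresh z (NominalData.absMk x u)) : Fresh z u := by
  obtain ⟨w, hw, -, hwx⟩ := exists_fresh_name u u {x}
  rw [Finset.mem_singleton] at hwx
  have h1 : NominalData.transp z w • NominalData.absMk x u = NominalData.absMk x u :=
    h.transp (hw.absMk hwx)
  rw [smul_absMk, transp_smul_of_ne hx.symm (Ne.symm hwx)] at h1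
  have h2 := hw.smul (NominalData.transp z w)
  rwa [absMk_injective x h1, transp_smul, Equiv.swap_apply_right] at h2

theorem absMk_surjective {X : Nom V} (a : absObj X) : ∃ x u, absMk x u = a :=
  Quotient.inductionOn a fun p => ⟨p.1, p.2, rfl⟩

theorem smul_absList {X : Nom V} (π : FinPerm V) {n : ℕ} (xs : Fin n → V) (u : X) :
    π • absList n xs u = absList n (fun j => π • xs j) (π • u) := by
  induction n with
  | zero => rfl
  | succ n ih => exact congrArg (absMk (π • xs 0)) (ih _)

theorem absPow_map_absList {X Y : Nom V} (f : X ⟶ Y) {n : ℕ} (xs : Fin n → V) (u : X) :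
    Nom.map ((absPow V n).map f) (absList n xs u) = absList n xs (Nom.map f u) := by
  induction n with
  | zero => rfl
  | succ n ih => exact congrArg (absMk (xs 0)) (ih _)

theorem absList_surjective {X : Nom V} (n : ℕ) (a : (absPow V n).obj X) :
    ∃ xs u, absList n xs u = a := by
  induction n with
  | zero => exact ⟨Fin.elim0, a, rfl⟩
  | succ n ih =>
    obtain ⟨x, b, rfl⟩ := absMk_surjective (X := (absPow V n).obj X) a
    obtain ⟨xs, u, rfl⟩ := ih b
    exact ⟨Fin.cons x xs, u, rfl⟩

theorem Fresh.absList {X : Nom V} {n : ℕ} {xs : Fin n → V} {z : V} {u : X}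
    (hx : ∀ j, z ≠ xs j) (hu : Fresh z u) : Fresh z (absList n xs u) := by
  induction n with
  | zero => exact hu
  | succ n ih => exact (ih fun j => hx j.succ).absMk (hx 0)

theorem Fresh.of_absList {X : Nom V} {n : ℕ} {xs : Fin n → V} {z : V} {u : X}
    (hx : ∀ j, z ≠ xs j) (h : Fresh z (NominalData.absList n xs u)) : Fresh z u := by
  induction n with
  | zero => exact h
  | succ n ih => exact ih (fun j => hx j.succ) (Fresh.of_absMk (hx 0) h)

/-- Abstractions over lists of names agree iff their bodies agree after the bound names have been
replaced by fresh ones. -/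
theorem absList_eq_iff {X : Nom V} {n : ℕ} {xs ys zs : Fin n → V} {u v : X}
    (hz : Function.Injective zs) (hx : ∀ i j, zs i ≠ xs j) (hy : ∀ i j, zs i ≠ ys j)
    (hu : ∀ i, Fresh (zs i) u) (hv : ∀ i, Fresh (zs i) v) :
    absList n xs u = absList n ys v ↔ listTransp xs zs • u = listTransp ys zs • v := by
  induction n generalizing u v with
  | zero =>
    simp only [listTransp, one_smul, absList]
    rfl
  | succ n ih =>
    have hz0 : ∀ j : Fin n, zs j.succ ≠ zs 0 := fun j h => Fin.succ_ne_zero j (hz h)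
    -- Renaming the outermost binder also acts on the inner binders, which may repeat it. The
    -- freshness conditions survive, and conjugation moves this transposition to the front of the
    -- remaining product, which gives `listTransp ws zs`.
    have key : ∀ {ws : Fin (n + 1) → V} {w : X}, (∀ i j, zs i ≠ ws j) → (∀ i, Fresh (zs i) w) →
        (∀ i j : Fin n, zs i.succ ≠ transp (ws 0) (zs 0) • ws j.succ) ∧
        (∀ i : Fin n, Fresh (zs i.succ) (transp (ws 0) (zs 0) • w)) ∧
        listTransp (fun j : Fin n => transp (ws 0) (zs 0) • ws j.succ) (fun j => zs j.succ) •
          transp (ws 0) (zs 0) • w = listTransp ws zs • w := by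
      intro ws w hw hfw
      have hfix : ∀ j : Fin n, transp (ws 0) (zs 0) • zs j.succ = zs j.succ := fun j =>
        transp_smul_of_ne (hw _ _) (hz0 j)
      refine ⟨fun i j h => hw i.succ j.succ (MulAction.injective (transp (ws 0) (zs 0)) ?_),
        fun i => ?_, ?_⟩
      · exact (hfix i).trans h
      · have := (hfw i.succ).smul (transp (ws 0) (zs 0))
        rwa [hfix] at this
      · have h1 := smul_listTransp (transp (ws 0) (zs 0)) (fun j : Fin n => ws j.succ)
          (fun j => zs j.succ)
        simp only [hfix] at h1
        rw [smul_smul, ← h1]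
        rfl
    obtain ⟨kx, kfx, kex⟩ := key hx hu
    obtain ⟨ky, kfy, key⟩ := key hy hv
    rw [← kex, ← key, ← ih (fun a b h => Fin.succ_injective _ (hz h)) kx ky kfx kfy,
      ← smul_absList, ← smul_absList]
    exact absMk_eq_iff (hx 0 0) (hy 0 0) ((hu 0).absList fun j => hx 0 _)
      ((hv 0).absList fun j => hy 0 _)

end Abstraction

/-! ### Change of fresh names in finite terms -/

section FiniteTerms

variable {V : Type u} [DecidableEq V] {S : BindingSig.{u}}

/-- If `a` is repeated in `xs`, its last occurrence decides the image, as the rightmost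
transposition acts first. Stated for a single name so that it can be used on free variables alone.
-/
theorem listTransp_listTransp_apply {n : ℕ} {xs zs vs : Fin n → V} {a : V}
    (hz : Function.Injective zs) (hv : Function.Injective vs) (hzx : ∀ i j, zs i ≠ xs j)
    (hvx : ∀ i j, vs i ≠ xs j) (hvz : ∀ i j, vs i ≠ zs j) (haz : ∀ j, a ≠ zs j)
    (hav : ∀ j, a ≠ vs j) :
    listTransp zs vs • listTransp xs zs • a = listTransp xs vs • a := by
  by_cases hax : ∃ j, xs j = a
  · obtain ⟨j, rfl, hj⟩ := exists_last hax
    rw [listTransp_last hz hzx j hj, listTransp_last hv hvx j hj,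
      listTransp_last hv hvz j (fun k hk hh => hk.ne' (hz hh))]
  · have h1 : ∀ j, a ≠ xs j := fun j hh => hax ⟨j, hh.symm⟩
    rw [listTransp_fix h1 haz, listTransp_fix haz hav, listTransp_fix h1 hav]

variable [Infinite V]

/-- The two permutations agree on the free variables, which is enough up to α; `zs` and `vs` may
occur bound in `t`. -/
theorem FinTerm.Alpha.listTransp_listTransp {n : ℕ} {xs zs vs : Fin n → V} {t : FinTerm V S}
    (hz : Function.Injective zs) (hv : Function.Injective vs) (hzx : ∀ i j, zs i ≠ xs j)
    (hvx : ∀ i j, vs i ≠ xs j) (hvz : ∀ i j, vs i ≠ zs j) (htz : ∀ j, zs j ∉ t.fv)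
    (htv : ∀ j, vs j ∉ t.fv) :
    Alpha (listTransp zs vs • listTransp xs zs • t) (listTransp xs vs • t) := by
  rw [smul_smul]
  refine .of_agree fun a ha => ?_
  rw [mul_smul]
  exact listTransp_listTransp_apply hz hv hzx hvx hvz (fun j h => htz j (h ▸ ha))
    (fun j h => htv j (h ▸ ha))

theorem FinTerm.Alpha.listTransp_iff {n : ℕ} {xs ys zs vs : Fin n → V} {t s : FinTerm V S}
    (hz : Function.Injective zs) (hv : Function.Injective vs)
    (hzx : ∀ i j, zs i ≠ xs j) (hzy : ∀ i j, zs i ≠ ys j)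
    (hvx : ∀ i j, vs i ≠ xs j) (hvy : ∀ i j, vs i ≠ ys j) (hvz : ∀ i j, vs i ≠ zs j)
    (htz : ∀ j, zs j ∉ t.fv) (htv : ∀ j, vs j ∉ t.fv)
    (hsz : ∀ j, zs j ∉ s.fv) (hsv : ∀ j, vs j ∉ s.fv) :
    Alpha (listTransp xs zs • t) (listTransp ys zs • s) ↔
      Alpha (listTransp xs vs • t) (listTransp ys vs • s) := by
  have h1 := Alpha.listTransp_listTransp hz hv hzx hvx hvz htz htv
  have h2 := Alpha.listTransp_listTransp hz hv hzy hvy hvz hsz hsv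
  constructor
  · intro h
    exact h1.symm.trans ((h.smul _).trans h2)
  · intro h
    have h3 := (h1.trans (h.trans h2.symm)).smul (listTransp zs vs)⁻¹
    rwa [inv_smul_smul, inv_smul_smul] at h3

/-- The names substituted for the bound ones need only be fresh for the free variables of the
arguments. -/
theorem FinTerm.Alpha.op_iff {o : S.Op} {xs ys zs : ∀ i : Fin (S.arity o), Fin (S.binds o i) → V}
    {ts ss : Fin (S.arity o) → FinTerm V S} (hz : ∀ i, Function.Injective (zs i))
    (hx : ∀ i j k, zs i j ≠ xs i k) (hy : ∀ i j k, zs i j ≠ ys i k)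
    (ht : ∀ i j, zs i j ∉ (ts i).fv) (hs : ∀ i j, zs i j ∉ (ss i).fv) :
    Alpha (.op o xs ts) (.op o ys ss) ↔
      ∀ i, Alpha (listTransp (xs i) (zs i) • ts i) (listTransp (ys i) (zs i) • ss i) := by
  constructor
  · intro h
    cases h with
    | op _ _ _ ws _ _ kd kf kargs =>
      intro i
      -- The given `zs` and the witnesses `ws` of the derivation may overlap, so they are compared
      -- through a third list disjoint from both.
      obtain ⟨vs, vinj, vfresh⟩ := exists_fresh_list ((((names_finite (FinTerm.op o xs ts)).union
        (names_finite (FinTerm.op o ys ss))).union (Set.finite_range (zs i))).union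
          (Set.finite_range (ws i))) (S.binds o i)
      simp only [Set.mem_union, not_or, Set.mem_range, not_exists] at vfresh
      have vx := fun j => names_arg (vfresh j).1.1.1 i
      have vy := fun j => names_arg (vfresh j).1.1.2 i
      have wx := fun j => names_arg (kf i j).1 i
      have wy := fun j => names_arg (kf i j).2 i
      have e1 := Alpha.listTransp_iff (kd i) vinj (fun j => (wx j).1) (fun j => (wy j).1)
        (fun j => (vx j).1) (fun j => (vy j).1) (fun j k h => (vfresh j).2 k h.symm)
        (fun j h => (wx j).2 (fv_subset_names _ h)) (fun j h => (vx j).2 (fv_subset_names _ h))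
        (fun j h => (wy j).2 (fv_subset_names _ h)) (fun j h => (vy j).2 (fv_subset_names _ h))
      have e2 := Alpha.listTransp_iff (hz i) vinj (hx i) (hy i)
        (fun j => (vx j).1) (fun j => (vy j).1) (fun j k h => (vfresh j).1.2 k h.symm)
        (ht i) (fun j h => (vx j).2 (fv_subset_names _ h))
        (hs i) (fun j h => (vy j).2 (fv_subset_names _ h))
      exact e2.2 (e1.1 (kargs i))
  · intro h
    -- The constructor wants names that occur nowhere in either term, which `zs` need not satisfy.
    choose vs vinj vfresh using fun i : Fin (S.arity o) => exists_fresh_list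
      (((names_finite (FinTerm.op o xs ts)).union
        (names_finite (FinTerm.op o ys ss))).union (Set.finite_range (zs i))) (S.binds o i)
    simp only [Set.mem_union, not_or, Set.mem_range, not_exists] at vfresh
    have vx := fun i j => names_arg (vfresh i j).1.1 i
    have vy := fun i j => names_arg (vfresh i j).1.2 i
    exact .op o xs ys vs ts ss vinj (fun i j => (vfresh i j).1) fun i =>
      (Alpha.listTransp_iff (hz i) (vinj i) (hx i) (hy i) (fun j => (vx i j).1)
        (fun j => (vy i j).1) (fun j k h => (vfresh i j).2 k h.symm)
        (ht i) (fun j h => (vx i j).2 (fv_subset_names _ h))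
        (hs i) (fun j h => (vy i j).2 (fv_subset_names _ h))).1 (h i)

end FiniteTerms

/-! ### α-equivalence of infinitary terms and equality of abstractions -/

section InfinitaryTerms

variable {V : Type u} {S : BindingSig.{u}}

theorem RawTerm.fv_trunc_subset (t : RawTerm V S) (n : ℕ) : (t.trunc n).fv ⊆ t.fv :=
  Set.subset_iUnion (fun n => (t.trunc n).fv) n

theorem FfvTerm.var_or_op (t : FfvTerm V S) :
    (∃ x, t = .var x) ∨ ∃ o xs ts, t = .op o xs ts := by
  obtain ⟨t, ht⟩ := t
  rcases t.var_or_op with ⟨x, rfl⟩ | ⟨o, xs, ts, rfl⟩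
  · exact Or.inl ⟨x, rfl⟩
  · refine Or.inr ⟨o, xs, fun i => ⟨ts i, ?_⟩, rfl⟩
    rw [RawTerm.fv_op] at ht
    -- An argument has at most the finitely many bound names as additional free variables.
    exact ((ht.subset (Set.subset_iUnion _ i)).union (Set.finite_range (xs i))).subset
      (by rw [Set.sdiff_union_self]; exact Set.subset_union_left)

variable [DecidableEq V]

/-- The truncation at depth 1 already displays the head; the same holds for the next two lemmas. -/
theorem RawTerm.Alpha.var_inj {x y : V} (h : (RawTerm.var x : RawTerm V S).Alpha (.var y)) :
    x = y := by
  cases h 1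
  rfl

theorem RawTerm.Alpha.not_var_op {x : V} {o : S.Op}
    {xs : ∀ i : Fin (S.arity o), Fin (S.binds o i) → V} {ts : Fin (S.arity o) → RawTerm V S} :
    ¬ (RawTerm.var x).Alpha (.op o xs ts) := fun h => nomatch h 1

theorem RawTerm.Alpha.op_inj {o o' : S.Op}
    {xs : ∀ i : Fin (S.arity o), Fin (S.binds o i) → V} {ts : Fin (S.arity o) → RawTerm V S}
    {ys : ∀ i : Fin (S.arity o'), Fin (S.binds o' i) → V} {ss : Fin (S.arity o') → RawTerm V S}
    (h : (RawTerm.op o xs ts).Alpha (.op o' ys ss)) : o = o' := by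
  cases h 1
  rfl

theorem FfvTerm.smul_var (π : FinPerm V) (x : V) :
    π • (.var x : FfvTerm V S) = .var (π • x) := Subtype.ext (RawTerm.smul_var π x)

theorem FfvTerm.smul_op (π : FinPerm V) (o : S.Op)
    (xs : ∀ i : Fin (S.arity o), Fin (S.binds o i) → V) (ts : Fin (S.arity o) → FfvTerm V S) :
    π • FfvTerm.op o xs ts = .op o (fun i j => π • xs i j) (fun i => π • ts i) :=
  Subtype.ext (RawTerm.smul_op π o xs fun i => (ts i).1)

variable [Infinite V]

/-- By definition each depth could come with its own fresh names. As `zs` avoids the free variables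
of the full arguments, it avoids those of every truncation, and the finite criterion applies at all
depths with the same `zs`. -/
theorem RawTerm.Alpha.op_iff {o : S.Op} {xs ys zs : ∀ i : Fin (S.arity o), Fin (S.binds o i) → V}
    {ts ss : Fin (S.arity o) → RawTerm V S} (hz : ∀ i, Function.Injective (zs i))
    (hx : ∀ i j k, zs i j ≠ xs i k) (hy : ∀ i j k, zs i j ≠ ys i k)
    (ht : ∀ i j, zs i j ∉ (ts i).fv) (hs : ∀ i j, zs i j ∉ (ss i).fv) :
    (RawTerm.op o xs ts).Alpha (.op o ys ss) ↔
      ∀ i, (listTransp (xs i) (zs i) • ts i).Alpha (listTransp (ys i) (zs i) • ss i) := by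
  have key : ∀ n, ((RawTerm.op o xs ts).trunc (n + 1)).Alpha ((RawTerm.op o ys ss).trunc (n + 1)) ↔
      ∀ i, ((listTransp (xs i) (zs i) • ts i).trunc n).Alpha
        ((listTransp (ys i) (zs i) • ss i).trunc n) := fun n => by
    simp only [trunc_smul, trunc_op]
    exact FinTerm.Alpha.op_iff hz hx hy (fun i j h => ht i j (fv_trunc_subset _ _ h))
      (fun i j h => hs i j (fv_trunc_subset _ _ h))
  refine ⟨fun h i n => (key n).1 (h (n + 1)) i, fun h n => ?_⟩
  cases n with
  | zero => exact .star
  | succ n => exact (key n).2 fun i => h i n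

theorem alphaMk_eq_iff {t s : FfvTerm V S} : alphaMk t = alphaMk s ↔ t.1.Alpha s.1 :=
  Quotient.eq (r := alphaSetoid V S)

theorem alphaMk_surjective (a : alphaTerms V S) : ∃ t, alphaMk t = a := Quotient.exists_rep a

theorem smul_alphaMk (π : FinPerm V) (t : FfvTerm V S) : π • alphaMk t = alphaMk (π • t) := rfl

/-- The free variables support the class: a permutation fixing them agrees with the identity on
those of each truncation. -/
theorem fresh_alphaMk {z : V} {t : FfvTerm V S} (h : z ∉ t.1.fv) : Fresh z (alphaMk t) := by
  refine Fresh.of_supports (S := t.2.toFinset) (fun g hg => ?_) (by simpa using h)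
  rw [smul_alphaMk, alphaMk_eq_iff]
  intro n
  change ((g • t.1).trunc n).Alpha (t.1.trunc n)
  have h := FinTerm.Alpha.of_agree (t := t.1.trunc n) (π := g) (σ := 1) fun a ha => by
    rw [one_smul]
    exact hg (t.2.mem_toFinset.2 (RawTerm.fv_trunc_subset _ _ ha))
  rwa [one_smul, ← RawTerm.trunc_smul] at h

/-- Classes of terms with the same head operation agree iff their arguments agree as
abstractions. -/
theorem alphaMk_op_eq_iff {o : S.Op} {xs ys : ∀ i : Fin (S.arity o), Fin (S.binds o i) → V}
    {ts ss : Fin (S.arity o) → FfvTerm V S} :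
    alphaMk (.op o xs ts) = alphaMk (.op o ys ss) ↔
      ∀ i, absList (S.binds o i) (xs i) (alphaMk (ts i)) =
        absList (S.binds o i) (ys i) (alphaMk (ss i)) := by
  choose zs hz hf using fun i : Fin (S.arity o) => exists_fresh_list
    ((((ts i).2.union (ss i).2).union (Set.finite_range (xs i))).union (Set.finite_range (ys i)))
    (S.binds o i)
  simp only [Set.mem_union, not_or, Set.mem_range, not_exists] at hf
  have hx : ∀ i j k, zs i j ≠ xs i k := fun i j k h => (hf i j).1.2 k h.symm
  have hy : ∀ i j k, zs i j ≠ ys i k := fun i j k h => (hf i j).2 k h.symm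
  refine alphaMk_eq_iff.trans ((RawTerm.Alpha.op_iff hz hx hy (fun i j => (hf i j).1.1.1)
    (fun i j => (hf i j).1.1.2)).trans (forall_congr' fun i => ?_))
  rw [absList_eq_iff (hz i) (hx i) (hy i) (fun j => fresh_alphaMk (hf i j).1.1.1)
    (fun j => fresh_alphaMk (hf i j).1.1.2), smul_alphaMk, smul_alphaMk, alphaMk_eq_iff]
  rfl

end InfinitaryTerms

theorem supp_finite {V : Type u} [DecidableEq V] {X : Nom V} (u : X) : (supp V u).Finite :=
  let ⟨T, hT⟩ := X.finSupp u
  T.finite_toSet.subset fun _ ha => ha T hT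

theorem exists_fresh_list_ffv {V : Type u} [Infinite V] {S : BindingSig.{u}}
    (t s : FfvTerm V S) {n : ℕ} (xs ys : Fin n → V) {A : Set V}
    (hA : A.Finite) : ∃ zs : Fin n → V, Function.Injective zs ∧ (∀ j, zs j ∉ t.1.fv) ∧
      (∀ j, zs j ∉ s.1.fv) ∧ (∀ i j, zs i ≠ xs j) ∧ (∀ i j, zs i ≠ ys j) ∧ ∀ j, zs j ∉ A := by
  obtain ⟨zs, hz, hf⟩ := exists_fresh_list
    ((((t.2.union s.2).union (Set.finite_range xs)).union (Set.finite_range ys)).union hA) n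
  simp only [Set.mem_union, not_or, Set.mem_range, not_exists] at hf
  exact ⟨zs, hz, fun j => (hf j).1.1.1.1, fun j => (hf j).1.1.1.2,
    fun i j h => (hf i).1.1.2 j h.symm, fun i j h => (hf i).1.2 j h.symm, fun j => (hf j).2⟩

/-! ### The final coalgebra of α-equivalence classes -/

section FinalCoalgebra

variable {V : Type u} [DecidableEq V] [Infinite V] {S : BindingSig.{u}}

theorem FCarrier.smul_inr {X : Nom V} (π : FinPerm V) (o : S.Op)
    (w : ∀ i : Fin (S.arity o), (absPow V (S.binds o i)).obj X) :
    π • (Sum.inr ⟨o, w⟩ : FCarrier V S X) = Sum.inr ⟨o, fun i => π • w i⟩ := rfl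

theorem FCarrier.smul_inr_absList {X : Nom V} (π : FinPerm V) (o : S.Op)
    (xs : ∀ i : Fin (S.arity o), Fin (S.binds o i) → V) (us : Fin (S.arity o) → X) :
    π • (Sum.inr ⟨o, fun i => absList (S.binds o i) (xs i) (us i)⟩ : FCarrier V S X) =
      Sum.inr ⟨o, fun i => absList (S.binds o i) (fun j => π • xs i j) (π • us i)⟩ := by
  simp only [smul_inr, smul_absList]

theorem FCarrier.inr_inj {X : Nom V} {o : S.Op}
    {w w' : ∀ i : Fin (S.arity o), (absPow V (S.binds o i)).obj X}
    (h : (Sum.inr ⟨o, w⟩ : FCarrier V S X) = Sum.inr ⟨o, w'⟩) (i : Fin (S.arity o)) :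
    w i = w' i := by
  cases h
  rfl

theorem FCarrier.exists_absList {X : Nom V} (b : FCarrier V S X) :
    (∃ x, b = Sum.inl x) ∨ ∃ (o : S.Op) (xs : ∀ i : Fin (S.arity o), Fin (S.binds o i) → V)
        (us : Fin (S.arity o) → X),
      b = Sum.inr ⟨o, fun i => absList (S.binds o i) (xs i) (us i)⟩ := by
  rcases b with x | ⟨o, w⟩
  · exact Or.inl ⟨x, rfl⟩
  · choose xs us h using fun i => absList_surjective _ (w i)
    exact Or.inr ⟨o, xs, us, by simp only [h]⟩

theorem FCarrier.fresh_arg {X : Nom V} {z : V} {o : S.Op}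
    {w : ∀ i : Fin (S.arity o), (absPow V (S.binds o i)).obj X}
    (h : Fresh z (Sum.inr ⟨o, w⟩ : FCarrier V S X)) (i : Fin (S.arity o)) : Fresh z (w i) := by
  obtain ⟨T, hT, hz⟩ := (fresh_iff _ _).1 h
  exact .of_supports (fun g hg => inr_inj (w := fun i => g • w i) (hT g hg) i) hz

theorem FFunctor.map_inl {X Y : Nom V} (f : X ⟶ Y) (x : V) :
    Nom.map ((FFunctor V S).map f) (Sum.inl x : FCarrier V S X) = (Sum.inl x : FCarrier V S Y) :=
  rfl

theorem FFunctor.map_inr {X Y : Nom V} (f : X ⟶ Y) (o : S.Op)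
    (xs : ∀ i : Fin (S.arity o), Fin (S.binds o i) → V) (us : Fin (S.arity o) → X) :
    Nom.map ((FFunctor V S).map f)
        (Sum.inr ⟨o, fun i => absList (S.binds o i) (xs i) (us i)⟩ : FCarrier V S X) =
      (Sum.inr ⟨o, fun i => absList (S.binds o i) (xs i) (Nom.map f (us i))⟩ :
        FCarrier V S Y) :=
  congrArg (fun w => (Sum.inr ⟨o, w⟩ : FCarrier V S Y))
    (funext fun i => absPow_map_absList f (xs i) (us i))

/-- `b` is the one-step unfolding of the class `a`. -/
inductive AlphaUnfolds : alphaTerms V S → FCarrier V S (alphaTerms V S) → Prop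
  | var (x : V) : AlphaUnfolds (alphaMk (.var x)) (Sum.inl x)
  | op (o : S.Op) (xs : ∀ i : Fin (S.arity o), Fin (S.binds o i) → V)
      (ts : Fin (S.arity o) → FfvTerm V S) : AlphaUnfolds (alphaMk (.op o xs ts))
        (Sum.inr ⟨o, fun i => absList (S.binds o i) (xs i) (alphaMk (ts i))⟩)

theorem AlphaUnfolds.exists (a : alphaTerms V S) : ∃ b, AlphaUnfolds a b := by
  obtain ⟨t, rfl⟩ := alphaMk_surjective a
  rcases t.var_or_op with ⟨x, rfl⟩ | ⟨o, xs, ts, rfl⟩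
  · exact ⟨_, .var x⟩
  · exact ⟨_, .op o xs ts⟩

/-- Well-definedness of the structure map. The equation `e` is kept separate so that both
derivations can be split into cases, although their indices are classes in a quotient. -/
theorem AlphaUnfolds.unique {a a' : alphaTerms V S} {b b' : FCarrier V S (alphaTerms V S)}
    (h : AlphaUnfolds a b) (h' : AlphaUnfolds a' b') (e : a = a') : b = b' := by
  rcases h with x | ⟨o, xs, ts⟩ <;> rcases h' with y | ⟨o', ys, ss⟩
  · rw [(alphaMk_eq_iff.1 e).var_inj]
  · exact absurd (alphaMk_eq_iff.1 e) RawTerm.Alpha.not_var_op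
  · exact absurd (alphaMk_eq_iff.1 e.symm) RawTerm.Alpha.not_var_op
  · obtain rfl := (alphaMk_eq_iff.1 e).op_inj
    simp only [alphaMk_op_eq_iff.1 e]

theorem AlphaUnfolds.smul (π : FinPerm V) {a : alphaTerms V S}
    {b : FCarrier V S (alphaTerms V S)} (h : AlphaUnfolds a b) :
    AlphaUnfolds (π • a) (π • b) := by
  rcases h with x | ⟨o, xs, ts⟩
  · rw [smul_alphaMk, FfvTerm.smul_var]
    exact .var _
  · rw [smul_alphaMk, FfvTerm.smul_op, FCarrier.smul_inr_absList]
    exact .op _ _ _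

variable (V S) in
/-- The structure map of the coalgebra of α-equivalence classes. -/
noncomputable def alphaDest : alphaTerms V S ⟶ (FFunctor V S).obj (alphaTerms V S) :=
  show alphaTerms V S →[FinPerm V] FObj V S (alphaTerms V S) from
  { toFun := fun a => (AlphaUnfolds.exists a).choose
    map_smul' := fun π a => (AlphaUnfolds.exists (π • a)).choose_spec.unique
      ((AlphaUnfolds.exists a).choose_spec.smul π) rfl }

theorem AlphaUnfolds.alphaDest_eq {a : alphaTerms V S} {b : FCarrier V S (alphaTerms V S)}
    (h : AlphaUnfolds a b) : Nom.map (alphaDest V S) a = b :=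
  (AlphaUnfolds.exists a).choose_spec.unique h rfl

theorem alphaDest_var (x : V) : Nom.map (alphaDest V S) (alphaMk (.var x)) =
    (Sum.inl x : FCarrier V S (alphaTerms V S)) := (AlphaUnfolds.var x).alphaDest_eq

theorem alphaDest_op (o : S.Op) (xs : ∀ i : Fin (S.arity o), Fin (S.binds o i) → V)
    (ts : Fin (S.arity o) → FfvTerm V S) : Nom.map (alphaDest V S) (alphaMk (.op o xs ts)) =
      (Sum.inr ⟨o, fun i => absList (S.binds o i) (xs i) (alphaMk (ts i))⟩ :
        FCarrier V S (alphaTerms V S)) := (AlphaUnfolds.op o xs ts).alphaDest_eq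

/-! #### Existence -/

section Unfold

variable {X : Nom V} (c : X ⟶ (FFunctor V S).obj X)

/-- One step of a raw unfolding, depending on a choice of representatives for abstractions. -/
noncomputable def unfoldStep (u : X) : rawFunctor V S X :=
  match (Nom.map c u : FCarrier V S X) with
  | Sum.inl x => ⟨Sum.inl x, Empty.elim⟩
  | Sum.inr ⟨o, w⟩ => ⟨Sum.inr ⟨o, fun i => (absList_surjective _ (w i)).choose⟩,
      fun i => (absList_surjective _ (w i)).choose_spec.choose⟩

/-- A raw term unfolding a state of the coalgebra `c`. -/
noncomputable def unfoldRaw : X → RawTerm V S := PFunctor.M.corec (unfoldStep c)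

/-- Hides the chosen representatives: later arguments only use that some list of binders and some
bodies represent the abstractions and are the ones unfolded. -/
theorem unfoldRaw_cases (u : X) :
    (∃ x, Nom.map c u = (Sum.inl x : FCarrier V S X) ∧ unfoldRaw c u = .var x) ∨
      ∃ (o : S.Op) (xs : ∀ i : Fin (S.arity o), Fin (S.binds o i) → V)
        (us : Fin (S.arity o) → X), Nom.map c u =
          (Sum.inr ⟨o, fun i => absList (S.binds o i) (xs i) (us i)⟩ : FCarrier V S X) ∧
        unfoldRaw c u = .op o xs fun i => unfoldRaw c (us i) := by
  rcases h : (Nom.map c u : FCarrier V S X) with x | ⟨o, w⟩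
  · refine Or.inl ⟨x, rfl, ?_⟩
    rw [unfoldRaw, PFunctor.M.corec_def, unfoldStep, h, RawTerm.var]
    refine congrArg PFunctor.M.mk (Sigma.ext rfl (heq_of_eq ?_))
    exact funext fun e => Empty.elim e
  · refine Or.inr ⟨o, fun i => (absList_surjective _ (w i)).choose,
      fun i => (absList_surjective _ (w i)).choose_spec.choose, ?_, ?_⟩
    · simp only [(absList_surjective _ (w _)).choose_spec.choose_spec]
      rfl
    · rw [unfoldRaw, PFunctor.M.corec_def, unfoldStep, h]
      rfl

/-- Equivariance of `c` keeps `z` fresh for the one-step unfolding. In each argument `z` is either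
among the binders, hence not free, or fresh for the body. -/
theorem Fresh.notMem_fv_unfoldRaw_trunc {z : V} {u : X} (h : Fresh z u) (n : ℕ) :
    z ∉ ((unfoldRaw c u).trunc n).fv := by
  induction n generalizing u with
  | zero => exact Set.notMem_empty z
  | succ n ih =>
    have hc : Fresh z (Nom.map c u) := h.map (Nom.map c)
    rcases unfoldRaw_cases c u with ⟨x, hx, e⟩ | ⟨o, xs, us, hx, e⟩
    · rw [e, RawTerm.trunc_var]
      rintro rfl
      rw [hx] at hc
      obtain ⟨T, hT, hz⟩ := (fresh_iff _ _).1 hc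
      -- A name is not fresh for itself: swapping it with another name outside `T` would have to fix
      -- it.
      obtain ⟨w, hw⟩ := Infinite.exists_notMem_finset (insert z T)
      rw [Finset.mem_insert, not_or] at hw
      have h1 := Supports.transp hT hz hw.2
      exact hw.1 ((Equiv.swap_apply_left z w).symm.trans (Sum.inl_injective h1))
    · rw [e, RawTerm.trunc_op]
      rintro hm
      obtain ⟨i, hi, hn⟩ := Set.mem_iUnion.1 hm
      rw [hx] at hc
      exact ih (Fresh.of_absList (fun j hj => hn ⟨j, hj.symm⟩) (FCarrier.fresh_arg hc i)) hi

theorem Fresh.notMem_fv_unfoldRaw {z : V} {u : X} (h : Fresh z u) :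
    z ∉ (unfoldRaw c u).fv := fun hz =>
  let ⟨n, hn⟩ := Set.mem_iUnion.1 hz
  h.notMem_fv_unfoldRaw_trunc c n hn

/-- The raw unfolding as a term with finitely many free variables. -/
noncomputable def unfoldFfv (u : X) : FfvTerm V S := ⟨unfoldRaw c u, by
  obtain ⟨T, hT⟩ := (X.finSupp u).exists_finset
  exact T.finite_toSet.subset fun z hz =>
    by_contra fun h => (hT z h).notMem_fv_unfoldRaw c hz⟩

/-- The binders chosen at `π • u` need not be the images of those chosen at `u`, so equivariance
holds only up to α. The induction needs all permutations, since renaming the binders alters `π`. -/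
theorem unfoldRaw_smul_trunc (π : FinPerm V) (u : X) (n : ℕ) :
    ((unfoldRaw c (π • u)).trunc n).Alpha (π • (unfoldRaw c u).trunc n) := by
  induction n generalizing u π with
  | zero => exact .star
  | succ n ih =>
    have hc : Nom.map c (π • u) = π • Nom.map c u := map_smul (Nom.map c) π u
    rcases unfoldRaw_cases c u with ⟨x, hx, e⟩ | ⟨o, xs, us, hx, e⟩ <;>
      rcases unfoldRaw_cases c (π • u) with ⟨y, hy, e'⟩ | ⟨o', ys, vs, hy, e'⟩ <;>
      rw [hx, hy] at hc
    · obtain rfl : y = π • x := Sum.inl_injective hc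
      rw [e, e', RawTerm.trunc_var, RawTerm.trunc_var, FinTerm.smul_var]
      exact .var _
    · exact nomatch hc
    · exact nomatch hc
    · replace hc := hc.trans (FCarrier.smul_inr_absList π o xs us)
      obtain rfl : o' = o := congrArg Sigma.fst (Sum.inr_injective hc)
      have hc := FCarrier.inr_inj hc
      -- The supports serve the comparison of abstractions in X. The free variables of the permuted
      -- truncation are avoided separately, as they are not yet known to be those of the unfolding
      -- of `π • us i`.
      choose zs hz hf1 hf2 hx hy hA using fun i => exists_fresh_list_ffv (unfoldFfv c (vs i))
        (unfoldFfv c (π • us i)) (ys i) (fun j => π • xs i j) (A := supp V (vs i) ∪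
          (supp V (π • us i) ∪ (π • (unfoldRaw c (us i)).trunc n).fv)) (by
        exact (supp_finite _).union ((supp_finite _).union
          ((FinTerm.names_finite _).subset (FinTerm.fv_subset_names _))))
      simp only [Set.mem_union, not_or] at hA
      rw [e, e', RawTerm.trunc_op, RawTerm.trunc_op, FinTerm.smul_op]
      refine (FinTerm.Alpha.op_iff hz hx hy ?_ fun i j => (hA i j).2.2).2 fun i => ?_
      · exact fun i j h => hf1 i j (RawTerm.fv_trunc_subset _ _ h)
      · have h1 := (absList_eq_iff (hz i) (hx i) (hy i) (fun j => (hA i j).1)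
          (fun j => (hA i j).2.1)).1 (hc i)
        have h2 := ih (listTransp (ys i) (zs i)) (vs i)
        have h3 := ih (listTransp (fun j => π • xs i j) (zs i) * π) (us i)
        rw [mul_smul, ← h1, mul_smul] at h3
        exact h2.symm.trans h3

/-- The coalgebra morphism into the α-equivalence classes. -/
noncomputable def unfold : X ⟶ alphaTerms V S :=
  show X →[FinPerm V] alphaTerms V S from
  { toFun := fun u => alphaMk (unfoldFfv c u)
    map_smul' := fun π u => alphaMk_eq_iff.2 fun n => by
      change ((unfoldRaw c (π • u)).trunc n).Alpha ((π • unfoldRaw c u).trunc n)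
      rw [RawTerm.trunc_smul]
      exact unfoldRaw_smul_trunc c π u n }

theorem unfold_comp_alphaDest :
    c ≫ (FFunctor V S).map (unfold c) = unfold c ≫ alphaDest V S := by
  refine Nom.hom_ext fun u => ?_
  change Nom.map ((FFunctor V S).map (unfold c)) (Nom.map c u) =
    Nom.map (alphaDest V S) (alphaMk (unfoldFfv c u))
  rcases unfoldRaw_cases c u with ⟨x, hx, e⟩ | ⟨o, xs, us, hx, e⟩
  · rw [show unfoldFfv c u = .var x from Subtype.ext e, hx, alphaDest_var, FFunctor.map_inl]
  · rw [show unfoldFfv c u = .op o xs fun i => unfoldFfv c (us i) from Subtype.ext e, hx,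
      alphaDest_op, FFunctor.map_inr]
    rfl

end Unfold

/-! #### Uniqueness -/

theorem alphaDest_alphaMk_eq_inl {t : FfvTerm V S} {x : V}
    (h : Nom.map (alphaDest V S) (alphaMk t) = (Sum.inl x : FCarrier V S (alphaTerms V S))) :
    t = .var x := by
  rcases t.var_or_op with ⟨y, rfl⟩ | ⟨o, ys, ts, rfl⟩
  · rw [alphaDest_var] at h
    rw [Sum.inl_injective h]
  · rw [alphaDest_op] at h
    exact nomatch h

theorem alphaDest_alphaMk_eq_inr {t : FfvTerm V S} {o : S.Op}
    {w : ∀ i : Fin (S.arity o), (absPow V (S.binds o i)).obj (alphaTerms V S)}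
    (h : Nom.map (alphaDest V S) (alphaMk t) =
      (Sum.inr ⟨o, w⟩ : FCarrier V S (alphaTerms V S))) :
    ∃ ys ts, t = .op o ys ts ∧ ∀ i, absList (S.binds o i) (ys i) (alphaMk (ts i)) = w i := by
  rcases t.var_or_op with ⟨y, rfl⟩ | ⟨o', ys, ts, rfl⟩
  · rw [alphaDest_var] at h
    exact nomatch h
  · rw [alphaDest_op] at h
    obtain rfl : o' = o := congrArg Sigma.fst (Sum.inr_injective h)
    exact ⟨ys, ts, rfl, FCarrier.inr_inj h⟩

/-- State and representatives vary in the induction, because the step is taken at renamed bodies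
rather than at the bodies themselves. -/
theorem trunc_alpha_of_comp_alphaDest {X : Nom V} {c : X ⟶ (FFunctor V S).obj X}
    {f g : X ⟶ alphaTerms V S} (hf : c ≫ (FFunctor V S).map f = f ≫ alphaDest V S)
    (hg : c ≫ (FFunctor V S).map g = g ≫ alphaDest V S) (n : ℕ) (u : X) (t s : FfvTerm V S)
    (ht : alphaMk t = Nom.map f u) (hs : alphaMk s = Nom.map g u) :
    (t.1.trunc n).Alpha (s.1.trunc n) := by
  induction n generalizing u t s with
  | zero => exact .star
  | succ n ih =>
    have hf' : Nom.map (alphaDest V S) (alphaMk t) =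
        Nom.map ((FFunctor V S).map f) (Nom.map c u) := by
      rw [ht]
      exact (congrArg (fun k => Nom.map k u) hf).symm
    have hg' : Nom.map (alphaDest V S) (alphaMk s) =
        Nom.map ((FFunctor V S).map g) (Nom.map c u) := by
      rw [hs]
      exact (congrArg (fun k => Nom.map k u) hg).symm
    rcases FCarrier.exists_absList (Nom.map c u : FCarrier V S X) with
      ⟨x, hx⟩ | ⟨o, xs, us, hx⟩
    · rw [hx, FFunctor.map_inl] at hf' hg'
      rw [alphaDest_alphaMk_eq_inl hf', alphaDest_alphaMk_eq_inl hg']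
      exact .var x
    · rw [hx, FFunctor.map_inr] at hf' hg'
      obtain ⟨ys, ts, rfl, ht'⟩ := alphaDest_alphaMk_eq_inr hf'
      obtain ⟨ys', ss, rfl, hs'⟩ := alphaDest_alphaMk_eq_inr hg'
      -- Three lists of binders meet here: `xs` in X, and `ys`, `ys'` from the two representatives.
      -- One list `zs` replaces all three; freshness for `us i` passes to its images under `f` and
      -- `g`.
      choose zs hz hzt hzs hy hy' hA using fun i => exists_fresh_list_ffv (ts i) (ss i)
        (ys i) (ys' i) (A := supp V (us i) ∪ Set.range (xs i)) (by
          exact (supp_finite _).union (Set.finite_range _))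
      simp only [Set.mem_union, not_or, Set.mem_range, not_exists] at hA
      have hxz : ∀ i j k, zs i j ≠ xs i k := fun i j k h => (hA i j).2 k h.symm
      have hu : ∀ i j, Fresh (zs i j) (us i) := fun i j => (hA i j).1
      change ((RawTerm.op o ys fun i => (ts i).1).trunc (n + 1)).Alpha
        ((RawTerm.op o ys' fun i => (ss i).1).trunc (n + 1))
      rw [RawTerm.trunc_op, RawTerm.trunc_op]
      refine (FinTerm.Alpha.op_iff hz hy hy' ?_ ?_).2 fun i => ?_
      · exact fun i j h => hzt i j (RawTerm.fv_trunc_subset _ _ h)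
      · exact fun i j h => hzs i j (RawTerm.fv_trunc_subset _ _ h)
      · rw [← RawTerm.trunc_smul, ← RawTerm.trunc_smul]
        -- By equivariance of `f` and `g`, the renamed arguments represent the images of one renamed
        -- state.
        refine ih (listTransp (xs i) (zs i) • us i) (listTransp (ys i) (zs i) • ts i)
          (listTransp (ys' i) (zs i) • ss i) ?_ ?_
        · rw [map_smul, ← smul_alphaMk]
          exact (absList_eq_iff (hz i) (hy i) (hxz i) (fun j => fresh_alphaMk (hzt i j))
            (fun j => (hu i j).map (Nom.map f))).1 (ht' i)
        · rw [map_smul, ← smul_alphaMk]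
          exact (absList_eq_iff (hz i) (hy' i) (hxz i) (fun j => fresh_alphaMk (hzs i j))
            (fun j => (hu i j).map (Nom.map g))).1 (hs' i)

theorem hom_eq_of_comp_alphaDest {X : Nom V} {c : X ⟶ (FFunctor V S).obj X}
    {f g : X ⟶ alphaTerms V S} (hf : c ≫ (FFunctor V S).map f = f ≫ alphaDest V S)
    (hg : c ≫ (FFunctor V S).map g = g ≫ alphaDest V S) : f = g := by
  refine Nom.hom_ext fun u => ?_
  obtain ⟨t, ht⟩ := alphaMk_surjective (Nom.map f u)
  obtain ⟨s, hs⟩ := alphaMk_surjective (Nom.map g u)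
  rw [← ht, ← hs, alphaMk_eq_iff]
  exact fun n => trunc_alpha_of_comp_alphaDest hf hg n u t s ht hs

variable (V S) in
/-- The α-equivalence classes form a final coalgebra. -/
noncomputable def alphaTermsIsTerminal :
    Limits.IsTerminal (⟨alphaTerms V S, alphaDest V S⟩ : Endofunctor.Coalgebra (FFunctor V S)) :=
  Limits.IsTerminal.ofUniqueHom (fun A => ⟨unfold A.str, unfold_comp_alphaDest A.str⟩)
    fun A m => Endofunctor.Coalgebra.Hom.ext
      (hom_eq_of_comp_alphaDest m.h (unfold_comp_alphaDest A.str))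

end FinalCoalgebra

/-! ### The functor of the λ-calculus -/

section LambdaFunctor

variable {V : Type u} [DecidableEq V]

/-- Equivariant bijections are isomorphisms of nominal sets. -/
def Nom.isoOfEquiv {X Y : Nom V} (e : X ≃ Y) (h : ∀ (π : FinPerm V) (u : X), e (π • u) = π • e u) :
    X ≅ Y where
  hom := show X →[FinPerm V] Y from ⟨e, h⟩
  inv := show Y →[FinPerm V] X from ⟨e.symm, fun π v => by
    rw [Equiv.symm_apply_eq, id, h, Equiv.apply_symm_apply]⟩
  hom_inv_id := Nom.hom_ext e.symm_apply_apply
  inv_hom_id := Nom.hom_ext e.apply_symm_apply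

variable [Infinite V]

/-- The functor of the signature of the λ-calculus is `V + [V]X + X × X`, on underlying sets. -/
def lamEquiv (X : Nom V) : FCarrier V lamSig.{u} X ≃ LCarrier V X where
  toFun
    | Sum.inl x => Sum.inl x
    | Sum.inr ⟨.abs, w⟩ => Sum.inr (Sum.inl (w (0 : Fin 1)))
    | Sum.inr ⟨.app, w⟩ => Sum.inr (Sum.inr (w (0 : Fin 2), w (1 : Fin 2)))
  invFun
    | Sum.inl x => Sum.inl x
    | Sum.inr (Sum.inl a) => Sum.inr ⟨.abs, fun i => match i with | ⟨0, _⟩ => a⟩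
    | Sum.inr (Sum.inr p) =>
      Sum.inr ⟨.app, fun i => match i with | ⟨0, _⟩ => p.1 | ⟨1, _⟩ => p.2⟩
  left_inv := by
    rintro (x | ⟨_ | _, w⟩)
    · rfl
    · refine congrArg (fun w => (Sum.inr ⟨.abs, w⟩ : FCarrier V lamSig.{u} X)) (funext fun i => ?_)
      match i with
      | ⟨0, _⟩ => rfl
    · refine congrArg (fun w => (Sum.inr ⟨.app, w⟩ : FCarrier V lamSig.{u} X)) (funext fun i => ?_)
      match i with
      | ⟨0, _⟩ => rfl
      | ⟨1, _⟩ => rfl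
  right_inv := by
    rintro (x | a | p) <;> rfl

theorem lamEquiv_smul {X : Nom V} (π : FinPerm V) (b : FCarrier V lamSig.{u} X) :
    lamEquiv X (π • b) = π • lamEquiv X b := by
  rcases b with x | ⟨_ | _, w⟩ <;> rfl

variable (V) in
/-- The functor of the signature of the λ-calculus is `V + [V]X + X × X`. -/
def lamNatIso : FFunctor V lamSig.{u} ≅ LFunctor V :=
  NatIso.ofComponents (fun X => Nom.isoOfEquiv (X := FObj V lamSig X) (Y := LObj V X)
    (lamEquiv X) lamEquiv_smul) fun f => Nom.hom_ext fun b => by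
      rcases (b : FCarrier V lamSig.{u} _) with x | ⟨_ | _, w⟩ <;> rfl

end LambdaFunctor

end NominalData

theorem mainTheorem1 {V : Type u} [DecidableEq V] [Countable V] [Infinite V] :
    (∀ S : BindingSig.{u}, ∃ ξ : alphaTerms V S ⟶ (FFunctor V S).obj (alphaTerms V S),
      (∀ x : V, Nom.map ξ (alphaMk (.var x)) = (Sum.inl x : FCarrier V S (alphaTerms V S))) ∧
      (∀ (o : S.Op) (xs : ∀ i : Fin (S.arity o), Fin (S.binds o i) → V)
        (ts : Fin (S.arity o) → FfvTerm V S),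
        Nom.map ξ (alphaMk (.op o xs ts)) =
          (Sum.inr ⟨o, fun i => absList (S.binds o i) (xs i) (alphaMk (ts i))⟩ :
            FCarrier V S (alphaTerms V S))) ∧
      Nonempty (Limits.IsTerminal (⟨alphaTerms V S, ξ⟩ : Endofunctor.Coalgebra (FFunctor V S)))) ∧
    ∃ ζ : alphaTerms V lamSig ⟶ (LFunctor V).obj (alphaTerms V lamSig),
      (∀ x : V, Nom.map ζ (alphaMk (.var x)) = (Sum.inl x : LCarrier V (alphaTerms V lamSig))) ∧
      (∀ (x : V) (M : FfvTerm V lamSig), Nom.map ζ (alphaMk (lam x M)) =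
        (Sum.inr (Sum.inl (absMk x (alphaMk M))) : LCarrier V (alphaTerms V lamSig))) ∧
      (∀ M N : FfvTerm V lamSig, Nom.map ζ (alphaMk (app M N)) =
        (Sum.inr (Sum.inr (alphaMk M, alphaMk N)) : LCarrier V (alphaTerms V lamSig))) ∧
      Nonempty (Limits.IsTerminal
        (⟨alphaTerms V lamSig, ζ⟩ : Endofunctor.Coalgebra (LFunctor V))) := by
  -- Isomorphic functors have equivalent categories of coalgebras. The equivalence preserves
  -- terminal objects and composes the structure map with the isomorphism, which is how the second
  -- witness arises.
  refine ⟨fun S => ⟨alphaDest V S, alphaDest_var, alphaDest_op, ⟨alphaTermsIsTerminal V S⟩⟩,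
    alphaDest V lamSig ≫ (lamNatIso V).hom.app (alphaTerms V lamSig), fun x => ?_, fun x M => ?_,
    fun M N => ?_, ⟨(alphaTermsIsTerminal V lamSig).isTerminalObj
      (Endofunctor.Coalgebra.equivOfNatIso (lamNatIso V)).functor _⟩⟩
  · exact congrArg (lamEquiv _) (alphaDest_var x)
  -- The lists of binders have length 1 here and 0 for application, so `absList` reduces to `absMk
  -- x` and to the identity.
  · exact congrArg (lamEquiv _) (alphaDest_op (S := lamSig.{u}) LamOp.abs _ _)
  · exact congrArg (lamEquiv _) (alphaDest_op (S := lamSig.{u}) LamOp.app _ _)
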